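/- **Setting.** Let $V$ be the space of traceless rational $2\times 2$ matrices with the form $(A,B)=\operatorname{tr}(AB)$, on which $\mathrm{SL}_2$ acts by conjugation, and put $u=\begin{pmatrix}0&1\\0&0\end{pmatrix}$, $u'=\begin{pmatrix}0&0\\-1&0\end{pmatrix}$, $h=\begin{pmatrix}1&0\\0&-1\end{pmatrix}$, $n(z)=\begin{pmatrix}1&z\\0&1\end{pmatrix}$. Let $\mathcal H_k=\mathcal H_k(V_{\mathbb C})\subset \operatorname{Sym}^k(V_{\mathbb C})$ be the space of harmonic tensors, with the form given by $(A^k,B^k)=(A,B)^k$, let $\pi_k$ be the orthogonal projection of $\operatorname{Sym}^k(V_{\mathbb C})$ to $\mathcal H_k$, and let $v_{2i}\in\mathcal H_k$ ($-k\le i\le k$) be the vectors of weight $2i$ for the diagonal torus with $v_0=\pi_k(h^k)$ and $Rv_{2i}=(i+k+1)v_{2i+2}$ for $i<k$, where $R=\begin{pmatrix}0&1\\0&0\end{pmatrix}\in\mathfrak{sl}_2$. Let $N\ge 1$, $\Gamma=\Gamma(N)$, $X=\Gamma\backslash\mathbb H$, and let $\overline X$ be its Borel–Serre compactification, the quotient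 by $\Gamma$ of $\overline{\mathbb H}=\mathbb H\sqcup\bigsqcup_{\ell\in\mathbb P^1(\mathbb Q)}(\mathbb P^1(\mathbb R)\setminus\{\ell\})$. Homology with coefficients in the local system $\widetilde{\mathcal H}_k$ is computed by the $\Gamma$-coinvariants of the singular chains of $\mathbb H$, respectively $\overline{\mathbb H}$, with coefficients in $\mathcal H_k$. Let $C_{\mathbf x}$ be the imaginary axis, oriented from its end $c'$ at the cusp $0$ to its end $c$ at the cusp $\infty$. For a cusp $\ell=g\infty$, $g\in \mathrm{SL}_2(\mathbb Z)$, let $X_\ell$ be the corresponding boundary circle of $\overline X$, of width $N$, and $X_{\ell,p}\otimes w$ the $1$-chain that runs once through $X_\ell$ from $p$ in the positive direction, with the parallel section starting at $w$. For $v\in\mathcal H_k$, a cap vector for $v$ at $\ell=g\infty$ is a vector $w\in\mathcal H_k$ with $$\gamma^{-1}w-w=v,\quad \gamma=g\,n(N)\,g^{-1},\qquad\text{and}\qquad \int_0^N \tfrac{(-1)^k}{N}\,\big(g\,n(x)\,u'^k,\,w\big)\,dx=0 .$$ If $w$ and $w'$ are cap vectors for $v$ at $\infty$ (with $g=1$)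 and at $0$ (with $g=\begin{pmatrix}0&-1\\1&0\end{pmatrix}$), the spectacle cycle is $$C^c_{\mathbf x}\otimes v=C_{\mathbf x}\otimes v-X_{\infty,c}\otimes w+X_{0,c'}\otimes w'.$$ **Theorem.** Let $k\ge 0$ and let $f=\sum_{n\ge 0}a_ne^{2\pi i nz/N}\in M_{2k+2}(\Gamma(N))$, not necessarily a cusp form. Let $\eta_f=f(z)\,dz\otimes n(z)u'^k$, a closed $\mathcal H_k$-valued $1$-form on $X$. Then the weight vectors $v_{2i}$ exist, and the integral $\int_0^\infty (f(iy)-a_0)\,y^s\,\frac{dy}{y}$ converges for $\operatorname{Re}(s)>2k+2$ and has an analytic continuation $\Lambda(f,s)$ to $\mathbb C\setminus\{0,2k+2\}$. For every integer $j$ with $-k+1\le j\le k-1$, cap vectors for $v_{2j}$ exist at $\infty$ and at $0$; for any choice of them $C^c_{\mathbf x}\otimes v_{2j}$ is a cycle in $\overline X$, and $$\big\langle[\eta_f],[C^c_{\mathbf x}\otimes v_{2j}]\big\rangle=c_{k,j}\,\Lambda(f,k+1-j),\qquad c_{k,j}=\frac{i(-i)^{k-j}\,2^k\,(k!)^2}{(k-j)!\,(k+j)!}.$$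 Here the pairing is understood through $H_1(X,\widetilde{\mathcal H}_k)\cong H_1(\overline X,\widetilde{\mathcal H}_k)$: the class of $C^c_{\mathbf x}\otimes v_{2j}$ in $H_1(\overline X,\widetilde{\mathcal H}_k)$ is represented by smooth cycles in $X$, and the integral of $\eta_f$ over each of them is the stated value. -/

import Mathlib

noncomputable section
open scoped MatrixGroups UpperHalfPlane ContDiff NNReal
open MvPolynomial
namespace Spectacle

/-- The basis `u`, `h = √2 e₂`, `u'` of the space `V_ℂ` of traceless `2 × 2` matrices. -/
def bas : Fin 3 → Matrix (Fin 2) (Fin 2) ℂ :=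
  ![!![0, 1; 0, 0], !![1, 0; 0, -1], !![0, 0; -1, 0]]

/-- The coordinates of a traceless matrix in the basis `u, h, u'`. -/
def coord (A : Matrix (Fin 2) (Fin 2) ℂ) : Fin 3 → ℂ := ![A 0 1, A 0 0, -A 1 0]

/-- The symmetric algebra of `V_ℂ`, realised as the polynomial ring in the basis vectors
`X 0 = u`, `X 1 = h`, `X 2 = u'`; `Sym^k(V_ℂ)` is its part of degree `k`. -/
abbrev SymV := MvPolynomial (Fin 3) ℂ

/-- A traceless matrix as a vector of `V_ℂ = Sym^1(V_ℂ)`. -/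
def vec (A : Matrix (Fin 2) (Fin 2) ℂ) : SymV := ∑ i, C (coord A i) * X i

/-- The bilinear form `(A, B) = tr (A B)` on `V_ℂ`. -/
def trForm (A B : Matrix (Fin 2) (Fin 2) ℂ) : ℂ := (A * B).trace

theorem sum_coord_smul_bas (A : Matrix (Fin 2) (Fin 2) ℂ) (hA : A.trace = 0) :
    ∑ i, coord A i • bas i = A := by
  have h : A 1 1 = - A 0 0 := by
    rw [Matrix.trace_fin_two] at hA; linear_combination hA
  ext i j
  fin_cases i <;> fin_cases j <;> simp [Fin.sum_univ_three, coord, bas, h]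

theorem trace_bas (i : Fin 3) : (bas i).trace = 0 := by
  fin_cases i <;> simp [bas, Matrix.trace_fin_two]

theorem vec_bas (i : Fin 3) : vec (bas i) = X i := by
  fin_cases i <;> simp [vec, bas, coord, Fin.sum_univ_three]

/-- Conjugation `g A g⁻¹`. -/
def conjMat (g : SL(2, ℂ)) (A : Matrix (Fin 2) (Fin 2) ℂ) : Matrix (Fin 2) (Fin 2) ℂ :=
  (g : Matrix (Fin 2) (Fin 2) ℂ) * A * ((g⁻¹ : SL(2, ℂ)) : Matrix (Fin 2) (Fin 2) ℂ)

theorem coe_inv_mul_coe (g : SL(2, ℂ)) :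
    ((g⁻¹ : SL(2, ℂ)) : Matrix (Fin 2) (Fin 2) ℂ) * (g : Matrix (Fin 2) (Fin 2) ℂ) = 1 := by
  rw [← Matrix.SpecialLinearGroup.coe_mul]; simp

theorem trace_conjMat (g : SL(2, ℂ)) (A : Matrix (Fin 2) (Fin 2) ℂ) :
    (conjMat g A).trace = A.trace := by
  rw [conjMat, Matrix.trace_mul_comm, ← Matrix.mul_assoc, coe_inv_mul_coe, Matrix.one_mul]

theorem conjMat_mul_conjMat (g : SL(2, ℂ)) (A B : Matrix (Fin 2) (Fin 2) ℂ) :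
    conjMat g A * conjMat g B = conjMat g (A * B) := by
  simp only [conjMat, Matrix.mul_assoc]
  rw [← Matrix.mul_assoc _ (g : Matrix (Fin 2) (Fin 2) ℂ) _, coe_inv_mul_coe, Matrix.one_mul]

/-- The action of `SL₂(ℂ)` on the symmetric algebra of `V_ℂ` induced by conjugation on `V_ℂ`. -/
def act (g : SL(2, ℂ)) : SymV →ₐ[ℂ] SymV := aeval fun i => vec (conjMat g (bas i))

theorem act_vec (g : SL(2, ℂ)) (A : Matrix (Fin 2) (Fin 2) ℂ) (hA : A.trace = 0) :
    act g (vec A) = vec (conjMat g A) := by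
  have h : conjMat g A = ∑ i, coord A i • conjMat g (bas i) := by
    conv_lhs => rw [← sum_coord_smul_bas A hA]
    simp [conjMat, Finset.mul_sum, Finset.sum_mul]
  rw [h]
  simp only [vec, act, map_sum, map_mul, aeval_X]
  simp [Fin.sum_univ_three, coord, algebraMap_eq]
  ring

theorem act_one : act 1 = AlgHom.id ℂ SymV := by
  apply MvPolynomial.algHom_ext
  intro i
  simp [act, conjMat, vec_bas]

theorem act_mul (g h : SL(2, ℂ)) : act (g * h) = (act g).comp (act h) := by
  apply MvPolynomial.algHom_ext
  intro i
  rw [AlgHom.comp_apply, ← vec_bas, act_vec _ _ (trace_bas i), act_vec _ _ (trace_bas i), act_vec]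
  · simp [conjMat, Matrix.mul_assoc]
  · rw [trace_conjMat, trace_bas]

/-- The Laplacian of the form `( , )`; it sends `A^k` to `k (k - 1) (A, A) A^(k-2)`. -/
def laplacian : SymV →ₗ[ℂ] SymV :=
  ∑ i, ∑ j, trForm (bas i) (bas j) • ((pderiv i).toLinearMap ∘ₗ (pderiv j).toLinearMap)

/-- The harmonic tensors `H_k(V_ℂ) ⊆ Sym^k(V_ℂ)`. -/
def Harm (k : ℕ) : Submodule ℂ SymV := homogeneousSubmodule (Fin 3) ℂ k ⊓ LinearMap.ker laplacian

theorem pderiv_act (g : SL(2, ℂ)) (i : Fin 3) (P : SymV) :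
    pderiv i (act g P) = ∑ j, C (coord (conjMat g (bas j)) i) * act g (pderiv j P) := by
  induction P using MvPolynomial.induction_on with
  | C a => simp [act]
  | add p q hp hq => simp only [map_add, hp, hq, mul_add, Finset.sum_add_distrib]
  | mul_X p n hp =>
    rw [map_mul, Derivation.leibniz, hp]
    have h1 : ∀ m : Fin 3, act g (X m) = vec (conjMat g (bas m)) := fun m => by simp [act]
    have h2 : ∀ A, pderiv i (vec A) = C (coord A i) := by
      intro A
      fin_cases i <;> simp [vec, Fin.sum_univ_three, pderiv_X]
    simp only [Derivation.leibniz, smul_eq_mul, map_add, map_mul, h1, h2, mul_add,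
      Finset.sum_add_distrib, pderiv_X]
    congr 1
    · fin_cases n <;> simp [Pi.single_apply, mul_comm]
    · rw [Finset.mul_sum]
      exact Finset.sum_congr rfl fun j _ => by ring

theorem gram_conj (g : SL(2, ℂ)) (k l : Fin 3) :
    ∑ i, ∑ j, trForm (bas i) (bas j) *
      (coord (conjMat g (bas l)) i * coord (conjMat g (bas k)) j) = trForm (bas l) (bas k) := by
  have h : trForm (conjMat g (bas l)) (conjMat g (bas k)) = trForm (bas l) (bas k) := by
    rw [trForm, conjMat_mul_conjMat, trace_conjMat, trForm]
  rw [← h]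
  conv_rhs =>
    rw [← sum_coord_smul_bas (conjMat g (bas l)) (by rw [trace_conjMat, trace_bas]),
      ← sum_coord_smul_bas (conjMat g (bas k)) (by rw [trace_conjMat, trace_bas])]
  simp only [trForm, Finset.sum_mul, Finset.mul_sum, Matrix.trace_sum, Matrix.smul_mul,
    Matrix.mul_smul, Matrix.trace_smul, smul_eq_mul]
  rw [Finset.sum_comm]
  refine Finset.sum_congr rfl fun i _ => Finset.sum_congr rfl fun j _ => ?_
  ring

theorem laplacian_act (g : SL(2, ℂ)) (P : SymV) :
    laplacian (act g P) = act g (laplacian P) := by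
  have h := gram_conj g
  simp only [laplacian, LinearMap.sum_apply, LinearMap.smul_apply, LinearMap.comp_apply,
    Derivation.coeFn_coe, pderiv_act, map_sum, Derivation.leibniz,
    map_smul, pderiv_C, smul_eq_mul, mul_zero, add_zero]
  have key : ∀ k l : Fin 3, trForm (bas l) (bas k) • act g (pderiv l (pderiv k P)) =
      ∑ i, ∑ j, trForm (bas i) (bas j) • (C (coord (conjMat g (bas k)) j) *
        (C (coord (conjMat g (bas l)) i) * act g (pderiv l (pderiv k P)))) := by
    intro k l
    rw [← h k l]
    simp only [smul_eq_C_mul, map_sum, map_mul, Finset.sum_mul]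
    refine Finset.sum_congr rfl fun i _ => Finset.sum_congr rfl fun j _ => ?_
    ring
  simp only [Finset.mul_sum, Finset.smul_sum, key]
  simp only [Fin.sum_univ_three]
  abel

theorem act_mem_Harm {k : ℕ} (g : SL(2, ℂ)) {P : SymV} (hP : P ∈ Harm k) : act g P ∈ Harm k := by
  obtain ⟨h1, h2⟩ := hP
  refine ⟨?_, ?_⟩
  · have h3 : ∀ i, (vec (conjMat g (bas i))).IsHomogeneous 1 := fun i => by
      refine IsHomogeneous.sum _ _ _ fun j _ => ?_
      simpa using (isHomogeneous_C (Fin 3) (coord (conjMat g (bas i)) j)).mul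
        (isHomogeneous_X ℂ j)
    have := IsHomogeneous.aeval (R := ℂ) (S := ℂ) (n := 1) ((mem_homogeneousSubmodule _ _).1 h1)
      (fun i => vec (conjMat g (bas i))) h3
    simpa [act] using this
  · have h3 : laplacian P = 0 := h2
    change laplacian (act g P) = 0
    rw [laplacian_act, h3, map_zero]


/-- The inclusion `SL₂(ℤ) ⊆ SL₂(ℂ)`. -/
def toC : SL(2, ℤ) →* SL(2, ℂ) := Matrix.SpecialLinearGroup.map (Int.castRingHom ℂ)

/-- The representation of `SL₂(ℤ)` on `H_k(V_ℂ)`. -/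
def rho (k : ℕ) : Representation ℂ SL(2, ℤ) (Harm k) where
  toFun γ := (act (toC γ)).toLinearMap.restrict fun _ hP => act_mem_Harm (toC γ) hP
  map_one' := by
    ext P
    simp [act_one]
  map_mul' γ δ := by
    ext P : 2
    simp only [LinearMap.restrict_apply, map_mul, act_mul, Module.End.mul_apply]
    rfl

/-- The bilinear form `( , )` on `Sym^k(V_ℂ)`, the extension of the form of `V_ℂ` with
`(A^k, B^k) = (A, B)^k`, in the basis of monomials: `u^a h^b u'^c` pairs non-trivially only with
`u^c h^b u'^a`, with value `a! b! c! / k! * (u, u')^(a + c) * (h, h)^b`, where `(u, u') = -1` and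
`(h, h) = 2`. -/
def form (k : ℕ) (P Q : SymV) : ℂ :=
  ∑ d ∈ Q.support, coeff (Finsupp.equivMapDomain Fin.revPerm d) P * coeff d Q *
    (((d 0).factorial * (d 1).factorial * (d 2).factorial : ℂ) / (k.factorial : ℂ) *
      ((-1) ^ (d 0 + d 2) * 2 ^ d 1))

/-- `(A^k, P)` is the value at `A` of `P`, read as a polynomial function through `( , )`. -/
theorem form_vec_pow (k : ℕ) (A : Matrix (Fin 2) (Fin 2) ℂ) (hA : A.trace = 0) (P : SymV)
    (hP : P.IsHomogeneous k) :
    form k (vec A ^ k) P = eval (fun i => trForm A (bas i)) P := by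
  have hA' : A 1 1 = - A 0 0 := by
    rw [Matrix.trace_fin_two] at hA; linear_combination hA
  rw [eval_eq', form]
  refine Finset.sum_congr rfl fun d hd => ?_
  have hdeg : d 0 + d 1 + d 2 = k := by
    have := hP (mem_support_iff.1 hd)
    rw [Finsupp.weight_apply, Finsupp.sum_fintype _ _ (by simp)] at this
    simpa [Fin.sum_univ_three] using this
  have hv : vec A = ∑ i, coord A i • (X i : SymV) := by
    simp [vec, smul_eq_C_mul]
  rw [hv, coeff_linearCombination_X_pow_of_fintype, Finsupp.sum_fintype _ _ (by simp),
    Finsupp.prod_fintype _ _ (by simp),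
    Finsupp.multinomial_eq_of_support_subset (Finset.subset_univ _)]
  have e0 : (Finsupp.equivMapDomain Fin.revPerm d) 0 = d 2 := by
    simp [Finsupp.equivMapDomain_apply]
  have e1 : (Finsupp.equivMapDomain Fin.revPerm d) 1 = d 1 := by
    simp [Finsupp.equivMapDomain_apply]
  have e2 : (Finsupp.equivMapDomain Fin.revPerm d) 2 = d 0 := by
    simp [Finsupp.equivMapDomain_apply]
  have hm := Nat.multinomial_spec Finset.univ (fun i => (Finsupp.equivMapDomain Fin.revPerm d) i)
  simp only [Fin.prod_univ_three, Fin.sum_univ_three, e0, e1, e2] at hm ⊢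
  have hs : d 2 + d 1 + d 0 = k := by omega
  rw [hs] at hm
  rw [if_pos hs]
  have hm' : ((d 2).factorial * (d 1).factorial * (d 0).factorial : ℂ) *
      (Nat.multinomial Finset.univ (fun i => (Finsupp.equivMapDomain Fin.revPerm d) i) : ℂ) =
        (k.factorial : ℂ) := by exact_mod_cast hm
  have hk : (k.factorial : ℂ) ≠ 0 := by exact_mod_cast k.factorial_ne_zero
  have t0 : trForm A (bas 0) = A 1 0 := by
    simp [trForm, bas, Matrix.trace_fin_two, Matrix.mul_apply]
  have t1 : trForm A (bas 1) = 2 * A 0 0 := by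
    simp [trForm, bas, Matrix.trace_fin_two, Matrix.mul_apply, hA']; ring
  have t2 : trForm A (bas 2) = - A 0 1 := by
    simp [trForm, bas, Matrix.trace_fin_two, Matrix.mul_apply]
  have c0 : coord A 0 = A 0 1 := rfl
  have c1 : coord A 1 = A 0 0 := rfl
  have c2 : coord A 2 = - A 1 0 := rfl
  rw [t0, t1, t2, c0, c1, c2, neg_pow (A 1 0), neg_pow (A 0 1), mul_pow, pow_add]
  have hone : ((-1 : ℂ) ^ d 0) * (-1) ^ d 0 = 1 := by
    rw [← mul_pow]; simp
  generalize (Nat.multinomial Finset.univ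
    (fun i => (Finsupp.equivMapDomain Fin.revPerm d) i) : ℂ) = m at hm' ⊢
  have : m * ((d 0).factorial * (d 1).factorial * (d 2).factorial : ℂ) / (k.factorial : ℂ) = 1 := by
    rw [div_eq_one_iff_eq hk, ← hm']; ring
  linear_combination ((A 0 1) ^ d 2 * (A 0 0) ^ d 1 * (A 1 0) ^ d 0 * coeff d P *
    (-1) ^ d 2 * 2 ^ d 1) * ((-1) ^ d 0 * (-1) ^ d 0 * this + hone)

/-- The defining property of the form on `Sym^k(V_ℂ)`. -/
theorem form_pow_pow (k : ℕ) (A B : Matrix (Fin 2) (Fin 2) ℂ) (hA : A.trace = 0)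
    (hB : B.trace = 0) : form k (vec A ^ k) (vec B ^ k) = trForm A B ^ k := by
  rw [form_vec_pow k A hA]
  · rw [map_pow]
    congr 1
    conv_rhs => rw [← sum_coord_smul_bas B hB]
    simp [vec, trForm, Finset.mul_sum, Matrix.trace_sum]
  · have : (vec B).IsHomogeneous 1 := by
      refine IsHomogeneous.sum _ _ _ fun j _ => ?_
      simpa using (isHomogeneous_C (Fin 3) (coord B j)).mul (isHomogeneous_X ℂ j)
    simpa using this.pow k

/-- The invariant `r² = e₁² + e₂² - e₃² = h² / 2 - 2 u u'`. -/
def rSq : SymV := C (1 / 2) * X 1 ^ 2 - C 2 * (X 0 * X 2)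

/-- `Q = π_k(P)`, the orthogonal projection of `P ∈ Sym^k(V_ℂ)` to `H_k(V_ℂ)` along the
decomposition `Sym^k(V_ℂ) = H_k(V_ℂ) ⊕ r² Sym^(k-2)(V_ℂ)`. -/
def IsHarmonicProjection (k : ℕ) (P Q : SymV) : Prop := Q ∈ Harm k ∧ rSq ∣ P - Q

/-- The diagonal matrix `diag(t, t⁻¹)`. -/
def diagMat (t : ℂˣ) : SL(2, ℂ) :=
  ⟨!![(t : ℂ), 0; 0, ((t⁻¹ : ℂˣ) : ℂ)], by simp [Matrix.det_fin_two]⟩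

/-- The upper triangular matrix `n(z)`. -/
def nMat (z : ℂ) : SL(2, ℂ) := ⟨!![1, z; 0, 1], by simp [Matrix.det_fin_two]⟩

/-- The raising operator: the action of `!![0, 1; 0, 0] ∈ sl₂` as a derivation. -/
def raising : Derivation ℂ SymV SymV :=
  mkDerivation ℂ fun i => vec (!![0, 1; 0, 0] * bas i - bas i * !![0, 1; 0, 0])

/-- `v i` is the weight vector `v_{2i}`, `-k ≤ i ≤ k`, of weight `2i` for the diagonal torus,
with the normalisations `v_0 = π_k(h^k)` and `R v_{2i} = (i + k + 1) v_{2i+2}`. -/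
structure IsWeightSystem (k : ℕ) (v : ℤ → Harm k) : Prop where
  weight : ∀ i : ℤ, -k ≤ i → i ≤ k → ∀ t : ℂˣ,
    act (diagMat t) (v i : SymV) = ((t ^ (2 * i) : ℂˣ) : ℂ) • (v i : SymV)
  zero : IsHarmonicProjection k (vec !![1, 0; 0, -1] ^ k) (v 0)
  raise : ∀ i : ℤ, -k ≤ i → i < k →
    raising (v i : SymV) = ((i : ℂ) + k + 1) • (v (i + 1) : SymV)

/-- The Borel-Serre enlargement of `ℍ`: to each cusp `ℓ ∈ ℙ¹(ℚ)` one adds the line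
`ℙ¹(ℝ) ∖ {ℓ}`, a principal homogeneous space of `N_ℓ(ℝ)`, whose point `x` is the end at `ℓ`
of the geodesic from `x` to `ℓ`. -/
inductive BorelSerre : Type
  | interior (z : ℍ) : BorelSerre
  | boundary (l : OnePoint ℚ) (x : OnePoint ℝ) (h : x ≠ l.map (Rat.castHom ℝ)) : BorelSerre

namespace BorelSerre

theorem map_smul_cusp (g : SL(2, ℤ)) (l : OnePoint ℚ) :
    (Matrix.SpecialLinearGroup.mapGL ℚ g • l).map (Rat.castHom ℝ) =
      Matrix.SpecialLinearGroup.mapGL ℝ g • l.map (Rat.castHom ℝ) := by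
  rw [OnePoint.map_smul]
  congr 1
  ext i j
  simp

instance : SMul SL(2, ℤ) BorelSerre where
  smul g
    | interior z => interior (g • z)
    | boundary l x h => boundary (Matrix.SpecialLinearGroup.mapGL ℚ g • l)
        (Matrix.SpecialLinearGroup.mapGL ℝ g • x)
        (by rw [map_smul_cusp]; exact fun h' => h (MulAction.injective _ h'))

theorem smul_interior (g : SL(2, ℤ)) (z : ℍ) : g • interior z = interior (g • z) := rfl

theorem smul_boundary (g : SL(2, ℤ)) (l : OnePoint ℚ) (x : OnePoint ℝ)
    (h : x ≠ l.map (Rat.castHom ℝ)) :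
    g • boundary l x h = boundary (Matrix.SpecialLinearGroup.mapGL ℚ g • l)
      (Matrix.SpecialLinearGroup.mapGL ℝ g • x)
      (by rw [map_smul_cusp]; exact fun h' => h (MulAction.injective _ h')) := rfl

instance : MulAction SL(2, ℤ) BorelSerre where
  one_smul p := by
    cases p <;> simp [smul_interior, smul_boundary]
  mul_smul g h p := by
    cases p <;> simp [smul_interior, smul_boundary, mul_smul]

/-- The chart at the cusp `g ∞`: `(x, t)` goes to `g (x + i / t)` if `t > 0`, and to the point
`g x` of the line at the cusp `g ∞` if `t = 0`. -/
def chart (g : SL(2, ℤ)) (p : ℝ × ℝ≥0) : BorelSerre :=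
  g • if h : 0 < p.2 then interior ⟨⟨p.1, (p.2 : ℝ)⁻¹⟩, by simpa using h⟩
    else boundary OnePoint.infty (p.1 : OnePoint ℝ) (by simp)

/-- The topology glued from the charts at all cusps. -/
instance : TopologicalSpace BorelSerre := ⨆ g : SL(2, ℤ), .coinduced (chart g) inferInstance

theorem continuous_chart (g : SL(2, ℤ)) : Continuous (chart g) :=
  continuous_iff_coinduced_le.2 (le_iSup (fun g : SL(2, ℤ) =>
    TopologicalSpace.coinduced (chart g) inferInstance) g)

theorem smul_chart (g h : SL(2, ℤ)) (p : ℝ × ℝ≥0) : g • chart h p = chart (g * h) p := by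
  simp only [chart, mul_smul]

instance : ContinuousConstSMul SL(2, ℤ) BorelSerre where
  continuous_const_smul g := by
    refine continuous_iSup_dom.2 fun h => continuous_coinduced_dom.2 ?_
    have : (fun p => g • p) ∘ chart h = chart (g * h) := funext fun p => smul_chart g h p
    rw [this]
    exact continuous_chart _

/-- The inclusion of `ℍ` into its Borel-Serre enlargement. -/
def incl : C(ℍ, BorelSerre) where
  toFun := interior
  continuous_toFun := by
    have h : interior = chart 1 ∘ fun z : ℍ => (z.re, (⟨z.im⁻¹, inv_nonneg.2 z.im_pos.le⟩ : ℝ≥0)) := by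
      funext z
      have hz : (0 : ℝ≥0) < ⟨z.im⁻¹, inv_nonneg.2 z.im_pos.le⟩ := inv_pos.2 z.im_pos
      simp only [Function.comp_apply, chart, one_smul, dif_pos hz]
      congr 1
      ext
      apply Complex.ext
      · rfl
      · change z.im = (z.im⁻¹)⁻¹
        rw [inv_inv]
    rw [h]
    refine (continuous_chart 1).comp ?_
    refine UpperHalfPlane.continuous_re.prodMk (Continuous.subtype_mk ?_ _)
    exact UpperHalfPlane.continuous_im.inv₀ fun z => z.im_pos.ne'

end BorelSerre

instance : ContinuousConstSMul SL(2, ℤ) ℍ where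
  continuous_const_smul g :=
    continuous_const_smul (Matrix.SpecialLinearGroup.mapGL ℝ g : GL (Fin 2) ℝ)

/-- Singular `n`-simplices. -/
abbrev Simplex (n : ℕ) (Y : Type) [TopologicalSpace Y] : Type :=
  C(stdSimplex ℝ (Fin (n + 1)), Y)

/-- Singular `n`-chains with coefficients in `E`. -/
abbrev Chain (n : ℕ) (Y : Type) [TopologicalSpace Y] (E : Type) [AddCommGroup E] : Type :=
  Simplex n Y →₀ E

section Homology

variable {Y : Type} [TopologicalSpace Y]

/-- The `i`-th face of a singular simplex. -/
def face {n : ℕ} (i : Fin (n + 2)) (s : Simplex (n + 1) Y) : Simplex n Y :=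
  s.comp ⟨stdSimplex.map i.succAbove, stdSimplex.continuous_map i.succAbove⟩

/-- The boundary operator `∂ (s ⊗ v) = ∑ (-1)^i (face i s) ⊗ v`. -/
def bdry (n k : ℕ) : Chain (n + 1) Y (Harm k) →ₗ[ℂ] Chain n Y (Harm k) :=
  ∑ i : Fin (n + 2), ((-1 : ℂ) ^ (i : ℕ)) • Finsupp.lmapDomain (Harm k) ℂ (face i)

variable [MulAction SL(2, ℤ) Y] [ContinuousConstSMul SL(2, ℤ) Y]

/-- The translate of a singular simplex by a group element. -/
def translate {n : ℕ} (g : SL(2, ℤ)) (s : Simplex n Y) : Simplex n Y :=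
  (⟨fun y => g • y, continuous_const_smul g⟩ : C(Y, Y)).comp s

/-- The relations `(γ s) ⊗ (γ v) = s ⊗ v`, `γ ∈ Γ(N)`. The quotient of `Chain n Y (Harm k)` by
these relations is the space of singular `n`-chains of `Γ(N) \ Y` with coefficients in the local
system associated to `H_k(V_ℂ)`: the class of `s ⊗ v` is the image of the simplex `s` together with
the parallel section `v` along it. -/
def coinvRel (N n k : ℕ) : Submodule ℂ (Chain n Y (Harm k)) :=
  Submodule.span ℂ {c | ∃ g ∈ CongruenceSubgroup.Gamma N, ∃ (s : Simplex n Y) (v : Harm k),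
    c = Finsupp.single (translate g s) (rho k g v) - Finsupp.single s v}

/-- The image of `Z` in the `1`-chains of `Γ(N) \ Y` with local coefficients is a cycle. -/
def IsCycle (N k : ℕ) (Z : Chain 1 Y (Harm k)) : Prop := bdry 0 k Z ∈ coinvRel N 0 k

/-- The images of `Z` and `Z'` in the `1`-chains of `Γ(N) \ Y` with local coefficients
differ by a boundary. -/
def Homologous (N k : ℕ) (Z Z' : Chain 1 Y (Harm k)) : Prop :=
  Z - Z' ∈ LinearMap.range (bdry (Y := Y) 1 k) ⊔ coinvRel N 1 k

end Homology

/-- A path as a singular `1`-simplex. -/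
def ofPath {Y : Type} [TopologicalSpace Y] (p : C(unitInterval, Y)) : Simplex 1 Y :=
  p.comp ⟨stdSimplexHomeomorphUnitInterval, stdSimplexHomeomorphUnitInterval.continuous⟩

/-- A singular `1`-simplex of `ℍ` as a function of a real parameter `t ∈ [0, 1]`. -/
def curve (s : Simplex 1 ℍ) (t : ℝ) : ℍ :=
  s (stdSimplexHomeomorphUnitInterval.symm (Set.projIcc 0 1 zero_le_one t))

/-- All the simplices of the chain are smooth. -/
def IsSmoothChain {k : ℕ} (Z : Chain 1 ℍ (Harm k)) : Prop :=
  ∀ s ∈ Z.support, ContDiffOn ℝ ∞ (fun t => (curve s t : ℂ)) (Set.Icc 0 1)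

/-- The coefficient of `dz` in the form `η_f = f(z) dz ⊗ (n(z) u')^k`. -/
def eta (k : ℕ) (f : ℍ → ℂ) (z : ℍ) : SymV := C (f z) * act (nMat z) (X 2) ^ k

/-- The integral of `(η_f, v)` along a smooth singular `1`-simplex. -/
def integralSimplex (k : ℕ) (f : ℍ → ℂ) (s : Simplex 1 ℍ) (v : Harm k) : ℂ :=
  ∫ t in (0 : ℝ)..1, form k (eta k f (curve s t)) v *
    derivWithin (fun t => (curve s t : ℂ)) (Set.Icc 0 1) t

/-- The integral of `η_f` over a smooth `1`-chain with coefficients. -/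
def integralChain (k : ℕ) (f : ℍ → ℂ) (Z : Chain 1 ℍ (Harm k)) : ℂ :=
  Z.sum fun s v => integralSimplex k f s v

/-- The image in the Borel-Serre enlargement of a `1`-chain of `ℍ`. -/
def push {k : ℕ} (Z : Chain 1 ℍ (Harm k)) : Chain 1 BorelSerre (Harm k) :=
  Z.mapDomain fun s => BorelSerre.incl.comp s

/-- The pairing `⟨[η_f], [S]⟩` of the de Rham class of `η_f` on `X = Γ(N) \ ℍ` with the homology
class of the cycle `S` of the Borel-Serre compactification `X̄`, under `H_1(X) ≅ H_1(X̄)`, is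
equal to `p`: the class of `S` comes from a smooth cycle of `X`, and `η_f` has integral `p` over
every smooth cycle of `X` whose class in `H_1(X̄)` is that of `S`. -/
def HasPairing (N k : ℕ) (f : ℍ → ℂ) (S : Chain 1 BorelSerre (Harm k)) (p : ℂ) : Prop :=
  (∃ Z : Chain 1 ℍ (Harm k), IsSmoothChain Z ∧ IsCycle N k Z ∧ Homologous N k (push Z) S) ∧
  ∀ Z : Chain 1 ℍ (Harm k), IsSmoothChain Z → IsCycle N k Z → Homologous N k (push Z) S →
    integralChain k f Z = p

/-- The modular symbol `C_𝐱 ⊗ v` for the imaginary axis `C_𝐱`, oriented from the boundary point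
`c'` at the cusp `0` to the boundary point `c` at the cusp `∞`, as the sum of its two halves: the
first is `t ↦ i t` and the second is `t ↦ i / (1 - t)`, for `0 ≤ t ≤ 1`. -/
def axis {k : ℕ} (v : Harm k) : Chain 1 BorelSerre (Harm k) :=
  Finsupp.single (ofPath ⟨fun t => BorelSerre.chart ModularGroup.S (0, unitInterval.toNNReal t),
    (BorelSerre.continuous_chart _).comp (by fun_prop)⟩) v +
  Finsupp.single (ofPath ⟨fun t => BorelSerre.chart 1
      (0, unitInterval.toNNReal (unitInterval.symm t)),
    (BorelSerre.continuous_chart _).comp (by fun_prop)⟩) v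

/-- The cap `X_{ℓ,c} ⊗ w`, `ℓ = g ∞`, `c = g z_∞`: the boundary circle of width `N`, run through
once from `c` in the positive direction, with the parallel section starting at `c` with `w`. -/
def cap (N : ℕ) (g : SL(2, ℤ)) {k : ℕ} (w : Harm k) : Chain 1 BorelSerre (Harm k) :=
  Finsupp.single (ofPath ⟨fun t => BorelSerre.chart g ((N : ℝ) * (t : ℝ), 0),
    (BorelSerre.continuous_chart g).comp (by fun_prop)⟩) w

/-- The vector `w` of the cap at the cusp `ℓ = g ∞` that bounds `c ⊗ v`: it solves
`γ⁻¹ w - w = v`, where `γ = g n(N) g⁻¹` is the positive generator of the stabiliser `Γ(N)_ℓ`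
(up to sign), and the integral over `X_{ℓ,c} ⊗ w` of the invariant form
`ω_{ℓ,k} = (-1)^k / N * dx ⊗ g n(x) u'^k` vanishes. -/
def IsCapVector (N k : ℕ) (g : SL(2, ℤ)) (v w : Harm k) : Prop :=
  rho k (g * ModularGroup.T ^ N * g⁻¹)⁻¹ w - w = v ∧
  ∫ x in (0 : ℝ)..N, (-1) ^ k / (N : ℂ) *
    form k (act (toC g * nMat (x : ℂ)) (X 2) ^ k) w = 0

/-- The spectacle cycle `C_𝐱^c ⊗ v = C_𝐱 ⊗ v - X_{∞,c} ⊗ w + X_{0,c'} ⊗ w'`. -/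
def spectacle (N : ℕ) {k : ℕ} (v w w' : Harm k) : Chain 1 BorelSerre (Harm k) :=
  axis v - cap N 1 w + cap N ModularGroup.S w'

/-- `L` is the completed `L`-function of `f`: the analytic continuation of
`∫_0^∞ (f(iy) - a₀) y^s dy / y`, where `f = ∑ a_n e^(2π i n z / N)`. -/
def IsCompletedL (N k : ℕ) (f : ℍ → ℂ) (L : ℂ → ℂ) : Prop :=
  DifferentiableOn ℂ L {0, 2 * (k : ℂ) + 2}ᶜ ∧
  ∀ s : ℂ, 2 * (k : ℝ) + 2 < s.re →
    MellinConvergent (fun y : ℝ => f (UpperHalfPlane.ofComplex (Complex.I * y)) -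
      (UpperHalfPlane.qExpansion N f).coeff 0) s ∧
    L s = mellin (fun y : ℝ => f (UpperHalfPlane.ofComplex (Complex.I * y)) -
      (UpperHalfPlane.qExpansion N f).coeff 0) s

/-- `c_{k,j} = i (-i)^(k-j) 2^k (k!)² / ((k-j)! (k+j)!)`. -/
def cConst (k : ℕ) (j : ℤ) : ℂ :=
  Complex.I * (-Complex.I) ^ (k - j) * 2 ^ k * (k.factorial : ℂ) ^ 2 /
    (((k - j).toNat.factorial : ℂ) * ((k + j).toNat.factorial : ℂ))

end Spectacle

end

/-!
The proof is elementary: no comparison theorem between singular and de Rham cohomology and no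
homotopy invariance of homology enters.

*Algebra.* The isotropic vectors of `V_ℂ` are the multiples of `n(z) u'` and of `u`. Restricting
an element of `Sym^k(V_ℂ)`, read as a polynomial function on `V_ℂ`, to the curve `z ↦ n(z) u'`
gives a polynomial of degree at most `2k` (`toPoly`). On `Sym^k(V_ℂ)` its kernel
is `r² Sym^(k-2)(V_ℂ)`, and it maps `H_k(V_ℂ)` isomorphically onto the polynomials of degree at most `2k`
(`eq_zero_of_toPoly_eq_zero`, `exists_toPoly_eq`). The group acts on these polynomials by Möbius
transformations with weight `-2k`, the raising operator becomes `-d/dz`, and `(η_f, v)` becomes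
`f(z) p(z) dz` with `p` the polynomial of `v` (`form_eta`). The weight vector `v_{2j}` becomes an
explicit multiple of `z ^ (k - j)` (`IsWeightSystem.toPoly_eq`). A cap vector becomes a polynomial
`q` of mean zero on `[0, N]` with `q(z + N) - q(z) = c z ^ m`, a rescaled Bernoulli polynomial up
to a constant; its degree is `m + 1`, and for `|j| < k` this is at most `2k` at both cusps.

*Topology.* Pushing the two caps along the imaginary axis until they meet at `i` exhibits the
spectacle cycle as homologous to a smooth cycle of `ℍ`, the difference of two horocycles with
coefficients (`homologous_innerCycle`). For the independence of the choice of the smooth cycle,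
let `G` be a primitive of `η_f` on `ℍ`, with values in the dual of `H_k(V_ℂ)`. Its integrals over
smooth chains are values of the coboundary of `G`, a cochain which only sees the end points of
simplices. By modularity `G` is invariant under `Γ(N)` up to a quantity that does not depend on
the point. Both facts survive when `G` is composed with any `Γ(N)`-equivariant map of sets from
the Borel–Serre enlargement to `ℍ` that is the identity on `ℍ`; continuity plays no role. Sending
the boundary point `x` at `∞` to `x + i`, and translating by `SL₂(ℤ)`, defines such a map
(`retract`), and the resulting cochain is constant on homology classes of the compactification
(`IsPotential.hasPairing`).

*Analysis.* It remains to integrate `f q` over the horocycle from `i` to `i + N`, and similarly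
for `f | S`. As the height `y` of the horocycle grows, the derivative of the integral is
`i f(iy) (q(iy + N) - q(iy)) = i c (iy) ^ m f(iy)`, by periodicity of `f`. With `f` replaced by `f - a₀`
the integral tends to `0`, so it is an integral over the half-line `y > 1`; the constant `a₀`
contributes `a₀ c i ^ (m + 1) / (m + 1)`, because `q` has mean zero (`primitive_sub_eq`). These
are the two halves of the Mellin integral for `Λ(f, k + 1 - j)` with its polar terms
(`Λ_natCast_add_one`), which is the Mellin transform of `f - a₀` continued by the functional
equation relating `f` and `f | S`.
-/

noncomputable section
open scoped MatrixGroups UpperHalfPlane ContDiff NNReal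
open MvPolynomial
namespace Spectacle

/-! ### Harmonic tensors as polynomials in one variable -/

/-- The restriction of an element of `Sym(V_ℂ)`, read as a polynomial function on `V_ℂ` through
`( , )`, to the curve `z ↦ n(z) u'` on the cone of isotropic vectors. -/
def toPoly : SymV →ₐ[ℂ] Polynomial ℂ :=
  aeval ![-1, -(2 * Polynomial.X), -Polynomial.X ^ 2]

@[simp] theorem toPoly_X_zero : toPoly (X 0) = -1 := by simp [toPoly]
@[simp] theorem toPoly_X_one : toPoly (X 1) = -(2 * Polynomial.X) := by simp [toPoly]
@[simp] theorem toPoly_X_two : toPoly (X 2) = -Polynomial.X ^ 2 := by simp [toPoly]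
@[simp] theorem toPoly_C (a : ℂ) : toPoly (C a) = Polynomial.C a := by
  simp [toPoly, Polynomial.algebraMap_eq]

/-- The isotropic matrix `n(z) u'`. -/
def coneMat (z : ℂ) : Matrix (Fin 2) (Fin 2) ℂ := !![-z, z ^ 2; -1, z]

theorem trace_coneMat (z : ℂ) : (coneMat z).trace = 0 := by
  simp [coneMat, Matrix.trace_fin_two]

theorem conjMat_nMat_bas (z : ℂ) : conjMat (nMat z) (bas 2) = coneMat z := by
  rw [conjMat, Matrix.SpecialLinearGroup.coe_inv, Matrix.adjugate_fin_two]
  ext i j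
  fin_cases i <;> fin_cases j <;> simp [nMat, bas, coneMat, pow_two]

/-- `toPoly P` is the value of `P`, read as a polynomial function through `( , )`, at `n(z) u'`. -/
theorem eval_toPoly (z : ℂ) (P : SymV) :
    (toPoly P).eval z = eval (fun i => trForm (coneMat z) (bas i)) P := by
  induction P using MvPolynomial.induction_on with
  | C a => simp
  | add p q hp hq => simp [hp, hq]
  | mul_X p i hp =>
    rw [map_mul, map_mul, Polynomial.eval_mul, hp, eval_X]
    congr 1
    fin_cases i <;> simp [coneMat, trForm, bas, Matrix.trace_fin_two]
    ring

theorem act_X_two (g : SL(2, ℂ)) : act g (X 2) = vec (conjMat g (bas 2)) := by simp [act]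

theorem form_C_mul (k : ℕ) (a : ℂ) (P Q : SymV) : form k (C a * P) Q = a * form k P Q := by
  simp only [form, coeff_C_mul, Finset.mul_sum]
  exact Finset.sum_congr rfl fun d _ => by ring

/-- The pairing of `η_f` with a section `v` is `f(z)` times the polynomial attached to `v`. -/
theorem form_eta (k : ℕ) (f : ℍ → ℂ) (z : ℍ) (v : Harm k) :
    form k (eta k f z) v = f z * (toPoly v).eval (z : ℂ) := by
  rw [eta, form_C_mul, act_X_two, conjMat_nMat_bas, form_vec_pow k _ (trace_coneMat _) _ v.2.1,
    eval_toPoly]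

theorem trForm_conjMat (g : SL(2, ℂ)) (A B : Matrix (Fin 2) (Fin 2) ℂ) :
    trForm A (conjMat g B) = trForm (conjMat g⁻¹ A) B := by
  rw [trForm, trForm, conjMat, conjMat, inv_inv, ← Matrix.mul_assoc, Matrix.trace_mul_comm,
    ← Matrix.mul_assoc, ← Matrix.mul_assoc]

theorem eval_vec (A B : Matrix (Fin 2) (Fin 2) ℂ) (hB : B.trace = 0) :
    eval (fun i => trForm A (bas i)) (vec B) = trForm A B := by
  conv_rhs => rw [← sum_coord_smul_bas B hB]
  simp [vec, trForm, Finset.mul_sum, Matrix.trace_sum]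

theorem eval_act (g : SL(2, ℂ)) (A : Matrix (Fin 2) (Fin 2) ℂ) (P : SymV) :
    eval (fun i => trForm A (bas i)) (act g P) =
      eval (fun i => trForm (conjMat g⁻¹ A) (bas i)) P := by
  induction P using MvPolynomial.induction_on with
  | C a => simp [act]
  | add p q hp hq => simp [hp, hq]
  | mul_X p i hp =>
    rw [map_mul, map_mul, map_mul, hp, eval_X, ← trForm_conjMat, ← eval_vec _ _
      (by rw [trace_conjMat, trace_bas])]
    simp [act]

theorem eval_smul_of_isHomogeneous {k : ℕ} {P : SymV} (hP : P.IsHomogeneous k) (c : ℂ)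
    (x : Fin 3 → ℂ) : eval (fun i => c * x i) P = c ^ k * eval x P := by
  rw [eval_eq', eval_eq', Finset.mul_sum]
  refine Finset.sum_congr rfl fun d hd => ?_
  have := hP (mem_support_iff.1 hd)
  rw [Finsupp.weight_apply, Finsupp.sum_fintype _ _ (by simp)] at this
  simp only [mul_pow, Finset.prod_mul_distrib, Finset.prod_pow_eq_pow_sum]
  rw [← this]
  simp
  ring

/-- Möbius equivariance of `toPoly`: on `Sym^k` the group acts on polynomials with weight
`-2k`, as conjugation by `g⁻¹` sends `n(g z) u'` to `(c z + d)⁻² n(z) u'`. The point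
`z'` stands for `g z`, in a form that needs no division. -/
theorem toPoly_act (g : SL(2, ℂ)) {k : ℕ} {P : SymV} (hP : P.IsHomogeneous k) (z z' : ℂ)
    (h : (g 1 0 * z + g 1 1) * z' = g 0 0 * z + g 0 1) :
    (g 1 0 * z + g 1 1) ^ (2 * k) * (toPoly (act g P)).eval z' = (toPoly P).eval z := by
  rw [eval_toPoly, eval_act, eval_toPoly, pow_mul, ← eval_smul_of_isHomogeneous hP]
  congr 2
  have hdet : g 0 0 * g 1 1 - g 0 1 * g 1 0 = 1 := by
    have := g.det_coe
    rwa [Matrix.det_fin_two] at this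
  have key : (g 1 0 * z + g 1 1) ^ 2 • conjMat g⁻¹ (coneMat z') = coneMat z := by
    rw [conjMat, inv_inv, Matrix.SpecialLinearGroup.coe_inv, Matrix.adjugate_fin_two]
    rw [Matrix.eta_fin_two (g : Matrix (Fin 2) (Fin 2) ℂ)]
    generalize g 0 0 = a at *
    generalize g 0 1 = b at *
    generalize g 1 0 = c at *
    generalize g 1 1 = d at *
    have h1 : d * (a * z + b) - b * (c * z + d) = z := by linear_combination z * hdet
    have h2 : a * (c * z + d) - c * (a * z + b) = 1 := by linear_combination hdet
    ext i j
    fin_cases i <;> fin_cases j <;> simp [coneMat]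
    all_goals grind
  funext i
  rw [← key]
  simp [trForm]

theorem raising_apply (P : SymV) :
    raising P = -(2 * X 0 * pderiv 1 P) - X 1 * pderiv 2 P := by
  have h : raising = -((2 * X 0 : SymV) • pderiv (R := ℂ) (1 : Fin 3)) -
      (X 1 : SymV) • pderiv (R := ℂ) (2 : Fin 3) := by
    refine MvPolynomial.derivation_ext fun i => ?_
    rw [raising, mkDerivation_X]
    fin_cases i <;> simp [vec, bas, coord, Fin.sum_univ_three, pderiv_X]
    norm_num
  rw [h]
  simp

/-- The raising operator generates the action of the matrices `n(t)`, which becomes the translation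
`z ↦ z - t` of the variable. -/
theorem derivative_toPoly (P : SymV) :
    Polynomial.derivative (toPoly P) = -toPoly (raising P) := by
  induction P using MvPolynomial.induction_on with
  | C a => simp
  | add p q hp hq => simp [hp, hq]; ring
  | mul_X p i hp =>
    rw [map_mul, Polynomial.derivative_mul, hp, Derivation.leibniz]
    fin_cases i <;> simp [raising_apply, pderiv_X]
    all_goals rw [map_ofNat toPoly 2]; ring

theorem pderiv_comm (i j : Fin 3) (P : SymV) :
    pderiv i (pderiv j P) = pderiv j (pderiv i P) := by
  have h : ⁅pderiv (R := ℂ) i, pderiv (R := ℂ) j⁆ = 0 :=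
    MvPolynomial.derivation_ext fun m => by
      simp [Derivation.commutator_apply, pderiv_X, Pi.single_apply, apply_ite]
  have := DFunLike.congr_fun h P
  rwa [Derivation.commutator_apply, Derivation.zero_apply, sub_eq_zero] at this

theorem laplacian_apply (P : SymV) :
    laplacian P = (2 : ℂ) • (pderiv 1 (pderiv 1 P) - pderiv 0 (pderiv 2 P)) := by
  have h : pderiv 2 (pderiv 0 P) = pderiv 0 (pderiv 2 P) := pderiv_comm _ _ _
  simp [laplacian, Fin.sum_univ_three, trForm, bas, h, smul_sub, Matrix.trace_fin_two]
  module

theorem mem_Harm_iff {k : ℕ} {P : SymV} :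
    P ∈ Harm k ↔ P.IsHomogeneous k ∧ pderiv 1 (pderiv 1 P) = pderiv 0 (pderiv 2 P) := by
  rw [Harm, Submodule.mem_inf, mem_homogeneousSubmodule, LinearMap.mem_ker, laplacian_apply,
    smul_eq_zero_iff_right two_ne_zero, sub_eq_zero]

theorem pderiv_mem_Harm {k : ℕ} {P : SymV} (hP : P ∈ Harm (k + 1)) (i : Fin 3) :
    pderiv i P ∈ Harm k := by
  rw [mem_Harm_iff] at hP ⊢
  refine ⟨hP.1.pderiv, ?_⟩
  rw [pderiv_comm 1 i, pderiv_comm 1 i, hP.2, pderiv_comm 2 i, pderiv_comm 0 i]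

theorem derivative_toPoly' (P : SymV) :
    Polynomial.derivative (toPoly P) =
      -(2 * toPoly (pderiv 1 P)) - 2 * Polynomial.X * toPoly (pderiv 2 P) := by
  rw [derivative_toPoly, raising_apply]
  simp only [map_sub, map_neg, map_mul, map_ofNat, toPoly_X_zero, toPoly_X_one]
  ring

/-- A harmonic tensor vanishing on the isotropic cone is zero: its gradient on the cone is normal
to the cone, and harmonicity together with Euler's identity makes it vanish there too. -/
theorem eq_zero_of_toPoly_eq_zero {k : ℕ} {P : SymV} (hP : P ∈ Harm k) (h : toPoly P = 0) :
    P = 0 := by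
  induction k generalizing P with
  | zero =>
    have := (mem_Harm_iff.1 hP).1
    rw [← totalDegree_zero_iff_isHomogeneous, totalDegree_eq_zero_iff_eq_C] at this
    rw [this, toPoly_C, Polynomial.C_eq_zero] at h
    rw [this, h, C_0]
  | succ k ih =>
    have hE := fun {m : ℕ} {Q : SymV} (hQ : Q ∈ Harm m) =>
      congrArg toPoly (mem_Harm_iff.1 hQ).1.sum_X_mul_pderiv
    have h2 := hE hP
    have h3 := hE (pderiv_mem_Harm hP 2)
    have h4 := derivative_toPoly' P
    have h5 := derivative_toPoly' (pderiv 1 P)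
    have h6 := derivative_toPoly' (pderiv 2 P)
    simp only [Fin.sum_univ_three, map_add, map_mul, toPoly_X_zero, toPoly_X_one, toPoly_X_two,
      map_natCast, h, map_zero, nsmul_eq_mul, mul_zero] at h2 h3 h4
    rw [pderiv_comm 2 1, (mem_Harm_iff.1 hP).2] at h5
    set p0 := toPoly (pderiv 0 P)
    set p1 := toPoly (pderiv 1 P)
    set p2 := toPoly (pderiv 2 P)
    have e1 : p1 = -Polynomial.X * p2 := by
      have : (2 : Polynomial ℂ) ≠ 0 := two_ne_zero
      refine mul_left_cancel₀ this ?_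
      linear_combination h4
    have e0 : p0 = Polynomial.X ^ 2 * p2 := by
      linear_combination -h2 - 2 * Polynomial.X * e1
    have e2 : p2 = 0 := by
      rw [e1, Polynomial.derivative_mul, Polynomial.derivative_neg, Polynomial.derivative_X] at h5
      have : (2 * k + 1 : Polynomial ℂ) * p2 = 0 := by
        linear_combination (-h5) + (-2) * h3 - Polynomial.X * h6
      refine (mul_eq_zero.1 this).resolve_left ?_
      exact_mod_cast (by positivity : (2 * k + 1 : ℕ) ≠ 0)
    have z2 := ih (pderiv_mem_Harm hP 2) e2
    have z1 := ih (pderiv_mem_Harm hP 1) (by change p1 = 0; rw [e1, e2, mul_zero])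
    have z0 := ih (pderiv_mem_Harm hP 0) (by change p0 = 0; rw [e0, e2, mul_zero])
    have := (mem_Harm_iff.1 hP).1.sum_X_mul_pderiv
    rw [Fin.sum_univ_three, z0, z1, z2] at this
    rw [nsmul_eq_mul] at this
    refine (mul_eq_zero.1 (by simpa using this.symm)).resolve_left ?_
    exact_mod_cast k.succ_ne_zero

theorem ext_toPoly {k : ℕ} {v w : Harm k} (h : toPoly v = toPoly w) : v = w := by
  refine Subtype.ext (sub_eq_zero.1 (eq_zero_of_toPoly_eq_zero (sub_mem v.2 w.2) ?_))
  rw [map_sub, h, sub_self]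

theorem raising_mem_Harm {k : ℕ} {P : SymV} (hP : P ∈ Harm k) : raising P ∈ Harm k := by
  rw [mem_Harm_iff] at hP ⊢
  constructor
  · obtain _ | k := k
    · have := hP.1
      rw [← totalDegree_zero_iff_isHomogeneous, totalDegree_eq_zero_iff_eq_C] at this
      rw [this]
      simpa using isHomogeneous_zero _ _ _
    · rw [raising_apply, mul_assoc, add_comm k 1, show (2 : SymV) = C 2 from (map_ofNat C 2).symm]
      exact (((isHomogeneous_X ℂ 0).mul hP.1.pderiv).C_mul 2).neg.sub
        ((isHomogeneous_X ℂ 1).mul hP.1.pderiv)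
  · have e1 := congrArg (pderiv 1) hP.2
    have e2 := congrArg (pderiv 2) hP.2
    have two (i : Fin 3) : pderiv i (2 : SymV) = 0 := by
      rw [show (2 : SymV) = C 2 from (map_ofNat C 2).symm, pderiv_C]
    simp only [raising_apply, map_sub, map_neg, map_add, pderiv_mul, two, pderiv_X]
    simp only [pderiv_comm 1 0, pderiv_comm 2 0, pderiv_comm 2 1] at e1 e2 ⊢
    simp
    linear_combination -2 * X 0 * e1 - X 1 * e2

/-- The powers of `z` are obtained by differentiating the polynomial `z ^ (2k)` of `(-u')^k`. -/
theorem exists_toPoly_eq_X_pow (k n : ℕ) (hn : n ≤ 2 * k) :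
    ∃ v : Harm k, toPoly v = Polynomial.X ^ (2 * k - n) := by
  induction n with
  | zero =>
    refine ⟨⟨C ((-1) ^ k) * X 2 ^ k, ?_⟩, ?_⟩
    · rw [mem_Harm_iff]
      refine ⟨(isHomogeneous_X_pow _ _).C_mul _, ?_⟩
      simp [pderiv_X]
    · simp only [map_mul, toPoly_C, map_pow, toPoly_X_two]
      rw [neg_pow (Polynomial.X ^ 2 : Polynomial ℂ), ← mul_assoc, map_neg, map_one, ← mul_pow]
      simp [← pow_mul]
  | succ n ih =>
    obtain ⟨v, hv⟩ := ih (by omega)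
    have hc : ((2 * k - n : ℕ) : ℂ) ≠ 0 := by exact_mod_cast (by omega : 2 * k - n ≠ 0)
    refine ⟨(-((2 * k - n : ℕ) : ℂ)⁻¹) • ⟨raising v, raising_mem_Harm v.2⟩, ?_⟩
    have h := derivative_toPoly (v : SymV)
    rw [hv, Polynomial.derivative_X_pow, eq_neg_iff_add_eq_zero, ← eq_neg_iff_add_eq_zero] at h
    have h' : toPoly (raising v) =
        -(Polynomial.C ((2 * k - n : ℕ) : ℂ) * Polynomial.X ^ (2 * k - n - 1)) := by
      rw [h]; simp
    rw [Submodule.coe_smul, map_smul, h', neg_smul_neg, ← Polynomial.smul_eq_C_mul, smul_smul,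
      inv_mul_cancel₀ hc, one_smul, Nat.sub_sub]

theorem exists_toPoly_eq {k : ℕ} {p : Polynomial ℂ} (hp : p.natDegree ≤ 2 * k) :
    ∃ v : Harm k, toPoly v = p := by
  have h (m : ℕ) : ∃ v : Harm k, m ≤ 2 * k → toPoly v = Polynomial.X ^ m := by
    by_cases hm : m ≤ 2 * k
    · obtain ⟨v, hv⟩ := exists_toPoly_eq_X_pow k (2 * k - m) (by omega)
      exact ⟨v, fun _ => by rw [hv, Nat.sub_sub_self hm]⟩
    · exact ⟨0, fun h => absurd h hm⟩
  choose e he using h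
  refine ⟨∑ m ∈ Finset.range (2 * k + 1), p.coeff m • e m, ?_⟩
  conv_rhs => rw [p.as_sum_range_C_mul_X_pow' (Nat.lt_succ_of_le hp)]
  rw [Submodule.coe_sum, map_sum]
  refine Finset.sum_congr rfl fun m hm => ?_
  rw [Submodule.coe_smul, map_smul, he m (by simp at hm; omega), Polynomial.smul_eq_C_mul]

/-! ### Weight vectors -/

theorem coeff_toPoly_act_diagMat (t : ℂˣ) {k : ℕ} {P : SymV} (hP : P.IsHomogeneous k) (n : ℕ) :
    (toPoly (act (diagMat t) P)).coeff n =
      ((t ^ (2 * ((k : ℤ) - n)) : ℂˣ) : ℂ) * (toPoly P).coeff n := by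
  have ht : (t : ℂ) ≠ 0 := t.ne_zero
  have h : toPoly (act (diagMat t) P) = Polynomial.C ((t : ℂ) ^ (2 * k)) *
      (toPoly P).comp (Polynomial.C ((t : ℂ)⁻¹ ^ 2) * Polynomial.X) := by
    refine Polynomial.funext fun z => ?_
    have := toPoly_act (diagMat t) hP ((t : ℂ)⁻¹ ^ 2 * z) z (by simp [diagMat]; field_simp)
    simp only [Polynomial.eval_mul, Polynomial.eval_C, Polynomial.eval_comp, Polynomial.eval_X,
      ← this]
    simp only [diagMat, Matrix.of_apply, Matrix.cons_val', Matrix.cons_val_zero,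
      Matrix.cons_val_one, Matrix.cons_val_fin_one, zero_mul, zero_add, Units.val_inv_eq_inv_val]
    rw [← mul_assoc, ← mul_pow, mul_inv_cancel₀ ht, one_pow, one_mul]
  rw [h, Polynomial.coeff_C_mul, Polynomial.comp_C_mul_X_coeff]
  push_cast
  rw [mul_sub, zpow_sub₀ ht]
  have : (t : ℂ) ^ (2 * (n : ℤ)) = (t ^ 2) ^ n := by rw [zpow_mul]; norm_cast
  rw [this, ← zpow_natCast]
  push_cast
  rw [inv_pow, inv_pow]
  field_simp

/-- The coefficient of the monomial attached to the weight vector `v_{2i}`, where `m = k - i`. -/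
def weightCoeff (k m : ℕ) : ℂ :=
  2 ^ k * (-1) ^ m * (k.factorial : ℂ) ^ 2 / ((m.factorial : ℂ) * ((2 * k - m).factorial : ℂ))

theorem weightCoeff_self (k : ℕ) : weightCoeff k k = (-2) ^ k := by
  have hk : (k.factorial : ℂ) ≠ 0 := by exact_mod_cast k.factorial_ne_zero
  rw [weightCoeff, two_mul, Nat.add_sub_cancel, ← mul_pow]
  field_simp

theorem weightCoeff_succ {k n : ℕ} (hn : n < 2 * k) :
    -((n : ℂ) + 1) * weightCoeff k (n + 1) = (2 * k - n) * weightCoeff k n := by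
  obtain ⟨r, hr⟩ := Nat.exists_eq_add_of_lt hn
  have h1 : 2 * k - (n + 1) = r := by omega
  have h2 : 2 * k - n = r + 1 := by omega
  have h3 : (2 * k : ℂ) = n + r + 1 := by exact_mod_cast hr
  have hn' : ((n : ℂ) + 1) ≠ 0 := by exact_mod_cast n.succ_ne_zero
  have hr' : ((r : ℂ) + 1) ≠ 0 := by exact_mod_cast r.succ_ne_zero
  have hf (m : ℕ) : (m.factorial : ℂ) ≠ 0 := by exact_mod_cast m.factorial_ne_zero
  have := hf n
  have := hf r
  rw [weightCoeff, weightCoeff, h1, h2, h3, Nat.factorial_succ, Nat.factorial_succ]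
  push_cast
  field_simp
  ring

/-- Standard representatives of the monomials of degree `k` modulo `r²`. -/
def coneSection (k : ℕ) : Polynomial ℂ →ₗ[ℂ] SymV :=
  Polynomial.lsum fun m => LinearMap.toSpanSingleton ℂ SymV
    (C ((-1) ^ k * (2 ^ (m % 2))⁻¹) *
      (X 0 ^ (k - (m + 1) / 2) * X 1 ^ (m % 2) * X 2 ^ (m / 2)))

/-- Modulo `r²` the square `h²` may be replaced by `4 u u'`, which leaves one monomial for each
value of `toPoly`. -/
theorem rSq_dvd_sub_coneSection {k : ℕ} {P : SymV} (hP : P.IsHomogeneous k) :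
    rSq ∣ P - coneSection k (toPoly P) := by
  rw [P.as_sum, map_sum, map_sum, ← Finset.sum_sub_distrib]
  refine Finset.dvd_sum fun d hd => ?_
  have hdeg : d 0 + d 1 + d 2 = k := by
    have := hP (mem_support_iff.1 hd)
    rw [Finsupp.weight_apply, Finsupp.sum_fintype _ _ (by simp)] at this
    simpa [Fin.sum_univ_three] using this
  have hq := Nat.div_add_mod (d 1) 2
  have e1 : monomial d (coeff d P) = C (coeff d P) *
      (X 0 ^ d 0 * (X 1 ^ (d 1 % 2) * (X 1 ^ 2) ^ (d 1 / 2)) * X 2 ^ d 2) := by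
    rw [← pow_mul, ← pow_add, add_comm (d 1 % 2), hq, monomial_eq,
      Finsupp.prod_fintype _ _ (by simp), Fin.prod_univ_three]
  have e2 : toPoly (monomial d (coeff d P)) =
      Polynomial.monomial (d 1 + 2 * d 2) (coeff d P * ((-1) ^ k * 2 ^ d 1)) := by
    rw [monomial_eq, Finsupp.prod_fintype _ _ (by simp), Fin.prod_univ_three, ← hdeg,
      ← Polynomial.C_mul_X_pow_eq_monomial]
    simp only [map_mul, map_pow, toPoly_C, toPoly_X_zero, toPoly_X_one, toPoly_X_two, map_neg,
      map_one, map_ofNat]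
    rw [neg_pow (2 * Polynomial.X : Polynomial ℂ), neg_pow (Polynomial.X ^ 2 : Polynomial ℂ),
      mul_pow, ← pow_mul]
    ring
  rw [e2, e1, coneSection, Polynomial.lsum_apply, Polynomial.sum_monomial_index _ _ (by simp),
    LinearMap.toSpanSingleton_apply]
  have h1 : (d 1 + 2 * d 2) % 2 = d 1 % 2 := by omega
  have h2 : (d 1 + 2 * d 2) / 2 = d 1 / 2 + d 2 := by omega
  have h3 : k - (d 1 + 2 * d 2 + 1) / 2 = d 0 + d 1 / 2 := by omega
  rw [h1, h2, h3, smul_eq_C_mul, ← mul_assoc (C _) (C _), ← C_mul]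
  have h4 : coeff d P * ((-1) ^ k * 2 ^ d 1) * ((-1) ^ k * (2 ^ (d 1 % 2))⁻¹) =
      coeff d P * 4 ^ (d 1 / 2) := by
    have : ((-1 : ℂ) ^ k) * (-1) ^ k = 1 := by rw [← mul_pow]; simp
    conv_lhs => rw [show (2 : ℂ) ^ d 1 = 4 ^ (d 1 / 2) * 2 ^ (d 1 % 2) by
      conv_lhs => rw [← hq]
      rw [pow_add, pow_mul]; norm_num]
    field_simp
    linear_combination (coeff d P) * this
  have h5 : rSq ∣ (X 1 ^ 2) ^ (d 1 / 2) - (C 4 * (X 0 * X 2)) ^ (d 1 / 2) := by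
    refine dvd_trans ⟨C 2, ?_⟩ (sub_dvd_pow_sub_pow _ _ _)
    rw [rSq, sub_mul, mul_right_comm, mul_right_comm (C 2), ← C_mul, ← C_mul]
    norm_num
  rw [h4, C_mul, C_pow]
  convert h5.mul_left (C (coeff d P) * X 0 ^ d 0 * X 1 ^ (d 1 % 2) * X 2 ^ d 2) using 1
  ring

theorem rSq_dvd_of_toPoly_eq {k : ℕ} {P Q : SymV} (hP : P.IsHomogeneous k)
    (hQ : Q.IsHomogeneous k) (h : toPoly P = toPoly Q) : rSq ∣ P - Q := by
  simpa [h] using rSq_dvd_sub_coneSection (hP.sub hQ)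

theorem toPoly_of_rSq_dvd_sub {P Q : SymV} (h : rSq ∣ P - Q) : toPoly P = toPoly Q := by
  obtain ⟨R, hR⟩ := h
  have h0 : toPoly rSq = 0 := by
    simp only [rSq, map_sub, map_mul, map_pow, toPoly_C, toPoly_X_zero, toPoly_X_one, toPoly_X_two]
    rw [neg_sq, mul_pow, ← mul_assoc, show (2 : Polynomial ℂ) = Polynomial.C 2 from
      (map_ofNat Polynomial.C 2).symm, ← map_pow, ← map_mul]
    norm_num
  rw [← sub_eq_zero, ← map_sub, hR, map_mul, h0, zero_mul]

theorem vec_h : vec !![1, 0; 0, -1] = X 1 := vec_bas 1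

theorem exists_isWeightSystem (k : ℕ) : ∃ v : ℤ → Harm k, IsWeightSystem k v := by
  have h (i : ℤ) : ∃ v : Harm k, -k ≤ i → toPoly v =
      Polynomial.C (weightCoeff k (k - i).toNat) * Polynomial.X ^ (k - i).toNat := by
    by_cases hi : -(k : ℤ) ≤ i
    · obtain ⟨v, hv⟩ := exists_toPoly_eq (k := k) (p := Polynomial.C (weightCoeff k (k - i).toNat) *
        Polynomial.X ^ (k - i).toNat) ((Polynomial.natDegree_C_mul_X_pow_le _ _).trans (by omega))
      exact ⟨v, fun _ => hv⟩
    · exact ⟨0, fun h => absurd h hi⟩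
  choose v hv using h
  refine ⟨v, fun i h1 h2 t => ?_, ⟨(v 0).2, ?_⟩, fun i h1 h2 => ?_⟩
  · have : (⟨act (diagMat t) (v i), act_mem_Harm _ (v i).2⟩ : Harm k) =
        ((t ^ (2 * i) : ℂˣ) : ℂ) • v i := by
      refine ext_toPoly (Polynomial.ext fun n => ?_)
      rw [coeff_toPoly_act_diagMat t (v i).2.1, Submodule.coe_smul, map_smul,
        Polynomial.coeff_smul, hv i h1, Polynomial.coeff_C_mul_X_pow, smul_eq_mul]
      split_ifs with hn
      · rw [hn, Int.toNat_of_nonneg (by omega), sub_sub_cancel]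
      · simp
    exact congrArg Subtype.val this
  · refine rSq_dvd_of_toPoly_eq ?_ (v 0).2.1 ?_
    · rw [vec_h]; exact isHomogeneous_X_pow _ _
    · rw [vec_h, hv 0 (by omega), map_pow, toPoly_X_one]
      simp only [sub_zero, Int.toNat_natCast, weightCoeff_self]
      rw [map_pow, ← mul_pow, map_neg, map_ofNat, neg_mul]
  · have : (⟨raising (v i), raising_mem_Harm (v i).2⟩ : Harm k) =
        ((i : ℂ) + k + 1) • v (i + 1) := by
      refine ext_toPoly ?_
      obtain ⟨n, hn⟩ : ∃ n : ℕ, (k : ℤ) - i = n + 1 := ⟨(k - i - 1).toNat, by omega⟩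
      have e1 : ((k : ℤ) - i).toNat = n + 1 := by omega
      have e2 : ((k : ℤ) - (i + 1)).toNat = n := by omega
      have e3 : (i : ℂ) + k + 1 = 2 * k - n := by
        have : i = k - n - 1 := by omega
        rw [this]; push_cast; ring
      have := derivative_toPoly (v i : SymV)
      rw [hv i h1, e1] at this
      rw [Submodule.coe_smul, map_smul, hv _ (by omega), e2, e3, ← neg_eq_iff_eq_neg.2 this,
        Polynomial.smul_eq_C_mul, ← mul_assoc, ← map_mul, ← weightCoeff_succ (by omega)]
      simp
      ring
    exact congrArg Subtype.val this

/-- The weight and raising relations determine the polynomials of the weight vectors. -/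
theorem IsWeightSystem.toPoly_eq {k : ℕ} {v : ℤ → Harm k} (hv : IsWeightSystem k v) {m : ℕ}
    (hm : m ≤ 2 * k) :
    toPoly (v (k - m)) = Polynomial.C (weightCoeff k m) * Polynomial.X ^ m := by
  -- the torus element `diag(2, 1/2)` already separates the weights
  have h1 (n : ℕ) (hn : n ≤ 2 * k) (l : ℕ) (hl : l ≠ n) : (toPoly (v (k - n))).coeff l = 0 := by
    have h := congrArg (fun P => (toPoly P).coeff l)
      (hv.weight (k - n) (by omega) (by omega) (Units.mk0 2 two_ne_zero))
    simp only [coeff_toPoly_act_diagMat _ (v (k - n)).2.1, map_smul, Polynomial.coeff_smul,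
      smul_eq_mul] at h
    refine (mul_eq_mul_right_iff.1 h).resolve_left fun h' => hl ?_
    simp only [Units.val_zpow_eq_zpow_val, Units.val_mk0] at h'
    have h'' : (2 : ℝ) ^ (2 * ((k : ℤ) - l)) = 2 ^ (2 * ((k : ℤ) - n)) := by
      simpa only [norm_zpow, Complex.norm_ofNat] using congrArg norm h'
    have := zpow_right_injective₀ (a := (2 : ℝ)) (by norm_num) (by norm_num) h''
    omega
  have h2 (n : ℕ) (hn : n ≤ 2 * k) :
      toPoly (v (k - n)) = Polynomial.C ((toPoly (v (k - n))).coeff n) * Polynomial.X ^ n := by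
    ext l
    rw [Polynomial.coeff_C_mul_X_pow]
    split_ifs with h
    · rw [h]
    · exact h1 n hn l h
  -- the middle coefficient is fixed by `v 0`, and the raising relations reach all others from it
  have h3 : (toPoly (v (k - k))).coeff k = weightCoeff k k := by
    rw [sub_self, ← toPoly_of_rSq_dvd_sub hv.zero.2, vec_h, map_pow, toPoly_X_one, ← neg_mul,
      ← map_ofNat Polynomial.C, ← map_neg, mul_pow, ← map_pow, Polynomial.coeff_C_mul_X_pow,
      if_pos rfl, weightCoeff_self]
  have h4 (n : ℕ) (hn : n < 2 * k) :
      -((n : ℂ) + 1) * (toPoly (v (k - (n + 1 : ℕ)))).coeff (n + 1) =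
        (2 * k - n) * (toPoly (v (k - n))).coeff n := by
    have h := congrArg (fun P => (toPoly P).coeff n)
      (hv.raise (k - (n + 1 : ℕ)) (by omega) (by omega))
    have e : (k : ℤ) - (n + 1 : ℕ) + 1 = k - n := by push_cast; ring
    simp only [e, map_smul, Polynomial.coeff_smul, smul_eq_mul] at h
    have h5 := congrArg (Polynomial.coeff · n) (derivative_toPoly (v (k - (n + 1 : ℕ)) : SymV))
    simp only [Polynomial.coeff_derivative, Polynomial.coeff_neg] at h5
    rw [← neg_eq_iff_eq_neg] at h5
    rw [← h5] at h
    push_cast at h ⊢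
    linear_combination h
  have h5 (n : ℕ) (hn : n < 2 * k) :
      (toPoly (v (k - n))).coeff n = weightCoeff k n ↔
        (toPoly (v (k - (n + 1 : ℕ)))).coeff (n + 1) = weightCoeff k (n + 1) := by
    have c1 : -((n : ℂ) + 1) ≠ 0 := neg_ne_zero.2 (by exact_mod_cast n.succ_ne_zero)
    have c2 : (2 * k - n : ℂ) ≠ 0 := sub_ne_zero.2 (by exact_mod_cast hn.ne')
    rw [← mul_right_inj' c2, ← h4 n hn, ← weightCoeff_succ hn, mul_right_inj' c1]
  have h6 : (toPoly (v (k - m))).coeff m = weightCoeff k m := by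
    rcases le_total k m with h | h
    · induction m, h using Nat.le_induction with
      | base => exact h3
      | succ m _ ih => exact (h5 m (by omega)).1 (ih (by omega))
    · induction h using Nat.decreasingInduction with
      | self => exact h3
      | of_succ m h ih => exact (h5 m (by omega)).2 (ih (by omega))
  rw [h2 m hm, h6]

/-! ### Cap vectors -/

theorem toPoly_rho {k : ℕ} (g : SL(2, ℤ)) (v : Harm k) (z z' : ℂ)
    (h : ((g 1 0 : ℂ) * z + g 1 1) * z' = g 0 0 * z + g 0 1) :
    ((g 1 0 : ℂ) * z + g 1 1) ^ (2 * k) * (toPoly (rho k g v)).eval z' = (toPoly v).eval z :=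
  toPoly_act (toC g) v.2.1 z z' h

theorem eval_toPoly_rho_T_inv {k : ℕ} (N : ℕ) (w : Harm k) (z : ℂ) :
    (toPoly (rho k (ModularGroup.T ^ N)⁻¹ w)).eval z = (toPoly w).eval (z + N) := by
  have h := toPoly_rho (ModularGroup.T ^ (-(N : ℤ))) w (z + N) z
    (by rw [ModularGroup.coe_T_zpow]; simp)
  rw [ModularGroup.coe_T_zpow, zpow_neg, zpow_natCast] at h
  simpa using h

theorem toPoly_rho_S_inv {k m : ℕ} (hm : m ≤ 2 * k) (c : ℂ) {v : Harm k}
    (hv : toPoly v = Polynomial.C c * Polynomial.X ^ m) :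
    toPoly (rho k ModularGroup.S⁻¹ v) =
      Polynomial.C (c * (-1) ^ m) * Polynomial.X ^ (2 * k - m) := by
  refine Polynomial.eq_of_infinite_eval_eq _ _ (Set.Infinite.mono ?_
    (Set.finite_singleton (0 : ℂ)).infinite_compl)
  intro z (hz : z ≠ 0)
  have h := toPoly_rho ModularGroup.S (rho k ModularGroup.S⁻¹ v) z (-z⁻¹)
    (by simp [ModularGroup.S, hz])
  rw [Representation.self_inv_apply, hv] at h
  change _ = _
  rw [← h]
  obtain ⟨r, hr⟩ := Nat.exists_eq_add_of_le hm
  simp [ModularGroup.S, hr, pow_add, neg_pow z⁻¹]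
  field_simp

/-- `q` solves the difference equation `q(z + N) - q(z) = p(z)` and has mean zero on `[0, N]`. -/
structure IsCapPoly (N : ℕ) (p q : Polynomial ℂ) : Prop where
  sub_eq : ∀ z : ℂ, q.eval (z + N) - q.eval z = p.eval z
  integral_eq_zero : ∫ x in (0 : ℝ)..N, q.eval (x : ℂ) = 0

theorem form_act_mul_nMat (k : ℕ) (g : SL(2, ℤ)) (x : ℂ) (w : Harm k) :
    form k (act (toC g * nMat x) (X 2) ^ k) w = (toPoly (rho k g⁻¹ w)).eval x := by
  have h : conjMat (toC g * nMat x) (bas 2) = conjMat (toC g) (coneMat x) := by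
    rw [← conjMat_nMat_bas]
    simp [conjMat, Matrix.mul_assoc]
  have e : ((rho k g⁻¹ w : Harm k) : SymV) = act (toC g⁻¹) w := rfl
  rw [act_X_two, h, form_vec_pow k _ (by rw [trace_conjMat, trace_coneMat]) _ w.2.1, eval_toPoly,
    e, map_inv, eval_act, inv_inv]

theorem isCapVector_iff {N k : ℕ} [NeZero N] (g : SL(2, ℤ)) (v w : Harm k) :
    IsCapVector N k g v w ↔ IsCapPoly N (toPoly (rho k g⁻¹ v)) (toPoly (rho k g⁻¹ w)) := by
  have h1 : rho k (g * ModularGroup.T ^ N * g⁻¹)⁻¹ w - w = v ↔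
      rho k (ModularGroup.T ^ N)⁻¹ (rho k g⁻¹ w) - rho k g⁻¹ w = rho k g⁻¹ v := by
    have e : rho k g⁻¹ (rho k (g * ModularGroup.T ^ N * g⁻¹)⁻¹ w) =
        rho k (ModularGroup.T ^ N)⁻¹ (rho k g⁻¹ w) := by
      rw [← Module.End.mul_apply, ← Module.End.mul_apply, ← map_mul, ← map_mul]
      congr 2
      group
    rw [← ((rho k).apply_bijective g⁻¹).1.eq_iff, map_sub, e]
  have hN : (N : ℂ) ≠ 0 := NeZero.ne _
  rw [IsCapVector, h1]
  simp only [form_act_mul_nMat, intervalIntegral.integral_const_mul]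
  rw [mul_eq_zero, or_iff_right (div_ne_zero (pow_ne_zero _ (by norm_num)) hN)]
  refine ⟨fun h => ⟨fun z => ?_, h.2⟩, fun h => ⟨ext_toPoly (Polynomial.funext fun z => ?_), h.2⟩⟩
  · rw [← h.1, ← eval_toPoly_rho_T_inv]
    simp
  · rw [← h.1, ← eval_toPoly_rho_T_inv]
    simp

/-- The solution is a Bernoulli polynomial, rescaled to the period `N`. -/
theorem exists_isCapPoly (N m : ℕ) [NeZero N] (c : ℂ) :
    ∃ q : Polynomial ℂ, q.natDegree ≤ m + 1 ∧
      IsCapPoly N (Polynomial.C c * Polynomial.X ^ m) q := by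
  have hN : (N : ℂ) ≠ 0 := NeZero.ne _
  have hm : (m : ℂ) + 1 ≠ 0 := by exact_mod_cast m.succ_ne_zero
  let B : Polynomial ℂ := (Polynomial.bernoulli (m + 1)).map (algebraMap ℚ ℂ)
  have hB (x : ℂ) : B.eval (x + 1) = B.eval x + (m + 1) * x ^ m := by
    have h := congrArg (fun p => (p.map (algebraMap ℚ ℂ)).eval x)
      (Polynomial.bernoulli_comp_one_add_X (m + 1))
    simpa [Polynomial.map_comp, add_comm, B] using h
  let q₀ : Polynomial ℂ := Polynomial.C (c * N ^ m / (m + 1)) *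
    B.comp (Polynomial.C (N : ℂ)⁻¹ * Polynomial.X)
  have h₀ (x : ℂ) : q₀.eval (x + N) - q₀.eval x = c * x ^ m := by
    simp only [q₀, Polynomial.eval_mul, Polynomial.eval_C, Polynomial.eval_comp,
      Polynomial.eval_X]
    rw [mul_add, inv_mul_cancel₀ hN, hB, mul_pow, inv_pow]
    field_simp
    ring
  have hdeg : q₀.natDegree ≤ m + 1 := by
    refine (Polynomial.natDegree_C_mul_le _ _).trans (Polynomial.natDegree_comp_le.trans ?_)
    refine (Nat.mul_le_mul ?_ ((Polynomial.natDegree_C_mul_le _ _).trans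
      Polynomial.natDegree_X_le)).trans_eq (mul_one (m + 1))
    refine Polynomial.natDegree_map_le.trans ?_
    rw [Polynomial.natDegree_le_iff_coeff_eq_zero]
    intro n hn
    rw [Polynomial.coeff_bernoulli, if_neg (by omega)]
  -- a constant is subtracted to make the mean vanish
  let a : ℂ := (∫ x in (0 : ℝ)..N, q₀.eval (x : ℂ)) / N
  refine ⟨q₀ - Polynomial.C a, Polynomial.natDegree_sub_C.trans_le hdeg, fun x => ?_, ?_⟩
  · simpa using h₀ x
  · simp only [Polynomial.eval_sub, Polynomial.eval_C]
    rw [intervalIntegral.integral_sub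
      ((by fun_prop : Continuous fun x : ℝ => q₀.eval (x : ℂ)).intervalIntegrable _ _) (by simp)]
    simp only [intervalIntegral.integral_const, a]
    simp
    field_simp
    simp

/-- The condition on `m` keeps the degree `m + 1` of the solution at most `2k`. -/
theorem exists_isCapVector {N k m : ℕ} [NeZero N] (g : SL(2, ℤ)) (v : Harm k) {c : ℂ}
    (hm : m < 2 * k)
    (hv : toPoly (rho k g⁻¹ v) = Polynomial.C c * Polynomial.X ^ m) :
    ∃ w, IsCapVector N k g v w := by
  obtain ⟨q, hq, hq'⟩ := exists_isCapPoly N m c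
  obtain ⟨w, hw⟩ := exists_toPoly_eq (k := k) (hq.trans hm)
  refine ⟨rho k g w, ?_⟩
  rw [isCapVector_iff, hv, Representation.inv_self_apply, hw]
  exact hq'

/-! ### Cochains, squares and cylinders -/

section Chains

variable {Y : Type} [TopologicalSpace Y]

/-- The `i`-th vertex of a singular simplex. -/
def vert {n : ℕ} (s : Simplex n Y) (i : Fin (n + 1)) : Y := s (stdSimplex.vertex i)

theorem vert_face {n : ℕ} (i : Fin (n + 2)) (s : Simplex (n + 1) Y) (j : Fin (n + 1)) :
    vert (face i s) j = vert s (i.succAbove j) := by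
  simp only [vert, face, ContinuousMap.comp_apply, ContinuousMap.coe_mk]
  rw [stdSimplex.map_vertex]

theorem vert_ofPath_zero (p : C(unitInterval, Y)) : vert (ofPath p) 0 = p 0 := rfl

theorem vert_ofPath_one (p : C(unitInterval, Y)) : vert (ofPath p) 1 = p 1 := rfl

/-- The `1`-cochain with coefficients that is the coboundary of the `0`-cochain `F`. -/
def cochain {k : ℕ} (F : Y → Harm k →ₗ[ℂ] ℂ) : Chain 1 Y (Harm k) →ₗ[ℂ] ℂ :=
  Finsupp.lsum ℂ fun s => F (vert s 1) - F (vert s 0)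

theorem cochain_single {k : ℕ} (F : Y → Harm k →ₗ[ℂ] ℂ) (s : Simplex 1 Y) (v : Harm k) :
    cochain F (Finsupp.single s v) = F (vert s 1) v - F (vert s 0) v := by
  simp [cochain]

theorem bdry_single (n k : ℕ) (s : Simplex (n + 1) Y) (v : Harm k) :
    bdry n k (Finsupp.single s v) =
      ∑ i : Fin (n + 2), ((-1 : ℂ) ^ (i : ℕ)) • Finsupp.single (face i s) v := by
  simp [bdry, Finsupp.lmapDomain_apply, Finsupp.mapDomain_single]

theorem cochain_bdry {k : ℕ} (F : Y → Harm k →ₗ[ℂ] ℂ) (c : Chain 2 Y (Harm k)) :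
    cochain F (bdry 1 k c) = 0 := by
  induction c using Finsupp.induction_linear with
  | zero => simp
  | add a b ha hb => rw [map_add, map_add, ha, hb, add_zero]
  | single s v =>
    rw [bdry_single, Fin.sum_univ_three]
    simp only [map_add, map_smul, cochain_single, vert_face]
    simp [Fin.succAbove]

variable [MulAction SL(2, ℤ) Y] [ContinuousConstSMul SL(2, ℤ) Y]

/-- A family of linear forms whose variation under the diagonal action of each element of `Γ(N)`
does not depend on the point. -/
def IsQuasiInvariant (N : ℕ) {k : ℕ} (F : Y → Harm k →ₗ[ℂ] ℂ) : Prop :=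
  ∀ g ∈ CongruenceSubgroup.Gamma N, ∀ (p q : Y) (v : Harm k),
    F (g • p) (rho k g v) - F p v = F (g • q) (rho k g v) - F q v

theorem IsQuasiInvariant.cochain_eq_zero {N k : ℕ} {F : Y → Harm k →ₗ[ℂ] ℂ}
    (hF : IsQuasiInvariant N F) {c : Chain 1 Y (Harm k)} (hc : c ∈ coinvRel N 1 k) :
    cochain F c = 0 := by
  rw [← LinearMap.mem_ker]
  refine Submodule.span_le.2 ?_ hc
  rintro _ ⟨g, hg, s, v, rfl⟩
  have h (i : Fin 2) : vert (translate g s) i = g • vert s i := rfl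
  rw [SetLike.mem_coe, LinearMap.mem_ker, map_sub, cochain_single, cochain_single, h, h]
  linear_combination hF g hg (vert s 1) (vert s 0) v

/-- The coboundary of a quasi-invariant family is a cocycle on the chains of the quotient. No
continuity of the family is needed. -/
theorem IsQuasiInvariant.cochain_eq {N k : ℕ} {F : Y → Harm k →ₗ[ℂ] ℂ}
    (hF : IsQuasiInvariant N F) {Z Z' : Chain 1 Y (Harm k)} (h : Homologous N k Z Z') :
    cochain F Z = cochain F Z' := by
  obtain ⟨_, ⟨b, rfl⟩, c, hc, hbc⟩ := Submodule.mem_sup.1 h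
  rw [← sub_eq_zero, ← map_sub, ← hbc, map_add, cochain_bdry, hF.cochain_eq_zero hc, add_zero]

theorem single_translate_sub_mem {N k n : ℕ} {g : SL(2, ℤ)} (hg : g ∈ CongruenceSubgroup.Gamma N)
    (s : Simplex n Y) (w : Harm k) :
    Finsupp.single (translate g s) w - Finsupp.single s (rho k g⁻¹ w) ∈ coinvRel N n k := by
  refine Submodule.subset_span ⟨g, hg, s, rho k g⁻¹ w, ?_⟩
  rw [Representation.self_inv_apply]

end Chains

section Square

variable {Y : Type} [TopologicalSpace Y]

/-- The two coordinates on the triangle with vertices `(0, 0)`, `(1, 0)`, `(1, 1)` of the unit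
square. -/
def triangle : C(stdSimplex ℝ (Fin 3), unitInterval × unitInterval) where
  toFun p := (unitInterval.symm ⟨p 0, stdSimplex.zero_le p 0, stdSimplex.le_one p 0⟩,
    ⟨p 2, stdSimplex.zero_le p 2, stdSimplex.le_one p 2⟩)
  continuous_toFun := by
    have h (i : Fin 3) : Continuous fun p : stdSimplex ℝ (Fin 3) => p i :=
      (continuous_apply i).comp continuous_subtype_val
    exact (unitInterval.continuous_symm.comp ((h 0).subtype_mk _)).prodMk ((h 2).subtype_mk _)

theorem stdSimplex_map_succAbove (i : Fin 3) (p : stdSimplex ℝ (Fin 2)) (j : Fin 2) :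
    stdSimplex.map i.succAbove p (i.succAbove j) = p j := by
  rw [stdSimplex.map_coe, FunOnFinite.linearMap_apply_apply]
  have : Finset.univ.filter (fun x => i.succAbove x = i.succAbove j) = {j} := by
    ext x; simp
  rw [this, Finset.sum_singleton]

theorem stdSimplex_map_self (i : Fin 3) (p : stdSimplex ℝ (Fin 2)) :
    stdSimplex.map i.succAbove p i = 0 := by
  rw [stdSimplex.map_coe, FunOnFinite.linearMap_apply_apply]
  have : Finset.univ.filter (fun x => i.succAbove x = i) = ∅ := by
    ext x; simp [Fin.succAbove_ne]
  rw [this, Finset.sum_empty]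

theorem face_zero_triangle (σ : C(unitInterval × unitInterval, Y)) :
    face 0 (σ.comp triangle) = ofPath (σ.comp ⟨fun t => (1, t), by fun_prop⟩) := by
  ext p
  refine congrArg σ (Prod.ext (Subtype.ext ?_) (Subtype.ext ?_))
  · change 1 - stdSimplex.map (Fin.succAbove 0) p 0 = 1
    rw [stdSimplex_map_self, sub_zero]
  · exact stdSimplex_map_succAbove 0 p 1

theorem face_one_triangle (σ : C(unitInterval × unitInterval, Y)) :
    face 1 (σ.comp triangle) = ofPath (σ.comp ⟨fun t => (t, t), by fun_prop⟩) := by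
  ext p
  refine congrArg σ (Prod.ext (Subtype.ext ?_) (Subtype.ext ?_))
  · change 1 - stdSimplex.map (Fin.succAbove 1) p ((1 : Fin 3).succAbove 0) = p 1
    rw [stdSimplex_map_succAbove, sub_eq_iff_eq_add, add_comm, stdSimplex.add_eq_one]
  · exact stdSimplex_map_succAbove 1 p 1

theorem face_two_triangle (σ : C(unitInterval × unitInterval, Y)) :
    face 2 (σ.comp triangle) = ofPath (σ.comp ⟨fun t => (t, 0), by fun_prop⟩) := by
  ext p
  refine congrArg σ (Prod.ext (Subtype.ext ?_) (Subtype.ext ?_))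
  · change 1 - stdSimplex.map (Fin.succAbove 2) p ((2 : Fin 3).succAbove 0) = p 1
    rw [stdSimplex_map_succAbove, sub_eq_iff_eq_add, add_comm, stdSimplex.add_eq_one]
  · exact stdSimplex_map_self 2 p

/-- The boundary of a singular square, cut into two triangles along the diagonal. -/
theorem square_mem_range_bdry {k : ℕ} (σ : C(unitInterval × unitInterval, Y)) (w : Harm k) :
    Finsupp.single (ofPath (σ.comp ⟨fun t => (1, t), by fun_prop⟩)) w
      + Finsupp.single (ofPath (σ.comp ⟨fun t => (t, 0), by fun_prop⟩)) w
      - Finsupp.single (ofPath (σ.comp ⟨fun t => (t, 1), by fun_prop⟩)) w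
      - Finsupp.single (ofPath (σ.comp ⟨fun t => (0, t), by fun_prop⟩)) w ∈
        LinearMap.range (bdry (Y := Y) 1 k) := by
  let τ : C(unitInterval × unitInterval, Y) := σ.comp ⟨Prod.swap, continuous_swap⟩
  refine ⟨Finsupp.single (σ.comp triangle) w - Finsupp.single (τ.comp triangle) w, ?_⟩
  rw [map_sub, bdry_single, bdry_single, Fin.sum_univ_three, Fin.sum_univ_three,
    face_zero_triangle, face_one_triangle, face_two_triangle, face_zero_triangle,
    face_one_triangle, face_two_triangle]
  have h0 : τ.comp ⟨fun t => (1, t), by fun_prop⟩ = σ.comp ⟨fun t => (t, 1), by fun_prop⟩ := rfl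
  have h1 : τ.comp ⟨fun t => (t, t), by fun_prop⟩ = σ.comp ⟨fun t => (t, t), by fun_prop⟩ := rfl
  have h2 : τ.comp ⟨fun t => (t, 0), by fun_prop⟩ = σ.comp ⟨fun t => (0, t), by fun_prop⟩ := rfl
  rw [h0, h1, h2]
  simp only [Fin.val_zero, Fin.val_one, Fin.val_two, pow_zero, pow_one, neg_one_sq, one_smul]
  abel

/-- A square whose right side is the translate of its left side by an element of the group bounds
its left side with coefficient the variation of the section. -/
theorem cylinder_mem [MulAction SL(2, ℤ) Y] [ContinuousConstSMul SL(2, ℤ) Y] {N k : ℕ}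
    {g : SL(2, ℤ)} (hg : g ∈ CongruenceSubgroup.Gamma N)
    (σ : C(unitInterval × unitInterval, Y)) (hσ : ∀ t, σ (1, t) = g • σ (0, t))
    {v w : Harm k} (hw : rho k g⁻¹ w - w = v) :
    Finsupp.single (ofPath (σ.comp ⟨fun t => (0, t), by fun_prop⟩)) v
      + Finsupp.single (ofPath (σ.comp ⟨fun t => (t, 0), by fun_prop⟩)) w
      - Finsupp.single (ofPath (σ.comp ⟨fun t => (t, 1), by fun_prop⟩)) w ∈
        LinearMap.range (bdry (Y := Y) 1 k) ⊔ coinvRel N 1 k := by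
  have h : ofPath (σ.comp ⟨fun t => (1, t), by fun_prop⟩) =
      translate g (ofPath (σ.comp ⟨fun t => (0, t), by fun_prop⟩)) := by
    ext p
    exact hσ _
  have h1 := square_mem_range_bdry σ w
  have h2 := single_translate_sub_mem hg (ofPath (σ.comp ⟨fun t => (0, t), by fun_prop⟩)) w
  rw [← h] at h2
  convert Submodule.sub_mem _ (Submodule.mem_sup_left h1) (Submodule.mem_sup_right h2) using 1
  rw [← hw, Finsupp.single_sub]
  abel

end Square

theorem bdry_ofPath {Y : Type} [TopologicalSpace Y] {k : ℕ} (p : C(unitInterval, Y)) (w : Harm k) :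
    bdry 0 k (Finsupp.single (ofPath p) w) =
      Finsupp.single (ContinuousMap.const _ (p 1) : Simplex 0 Y) w -
        Finsupp.single (ContinuousMap.const _ (p 0) : Simplex 0 Y) w := by
  have h (i : Fin 2) (s : Simplex 1 Y) :
      face i s = ContinuousMap.const _ (vert s (i.succAbove 0)) := by
    ext q
    rw [ContinuousMap.const_apply, ← vert_face, vert]
    congr 1
    subsingleton
  rw [bdry_single, Fin.sum_univ_two, h, h]
  change _ • Finsupp.single (ContinuousMap.const _ (vert (ofPath p) 1)) w +
    _ • Finsupp.single (ContinuousMap.const _ (vert (ofPath p) 0)) w = _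
  rw [vert_ofPath_zero, vert_ofPath_one]
  simp
  exact (sub_eq_add_neg _ _).symm

/-- A path closed up by a group element has, with coefficient `w`, the boundary `p(0) ⊗ v`
where `v` is the variation of `w`. -/
theorem bdry_ofPath_sub_mem {Y : Type} [TopologicalSpace Y] [MulAction SL(2, ℤ) Y]
    [ContinuousConstSMul SL(2, ℤ) Y] {N k : ℕ}
    {g : SL(2, ℤ)} (hg : g ∈ CongruenceSubgroup.Gamma N) (p : C(unitInterval, Y))
    (hp : p 1 = g • p 0) {v w : Harm k} (hw : rho k g⁻¹ w - w = v) :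
    bdry 0 k (Finsupp.single (ofPath p) w) -
      Finsupp.single (ContinuousMap.const _ (p 0) : Simplex 0 Y) v ∈ coinvRel N 0 k := by
  have h := single_translate_sub_mem hg (ContinuousMap.const _ (p 0) : Simplex 0 Y) w
  have e : translate g (ContinuousMap.const _ (p 0) : Simplex 0 Y) =
      ContinuousMap.const _ (p 1) := by
    ext q
    exact hp.symm
  rw [e] at h
  convert h using 1
  rw [bdry_ofPath, ← hw, Finsupp.single_sub]
  abel

/-! ### Translations in the Borel–Serre enlargement -/

/-- The path `i + N t`, `0 ≤ t ≤ 1`, in the upper half plane. -/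
def horocycle (N : ℕ) : C(unitInterval, ℍ) where
  toFun t := ⟨⟨N * (t : ℝ), 1⟩, one_pos⟩
  continuous_toFun := by
    refine UpperHalfPlane.isEmbedding_coe.continuous_iff.2 ?_
    change Continuous fun t : unitInterval => (⟨N * (t : ℝ), 1⟩ : ℂ)
    simp only [Complex.mk_eq_add_mul_I]
    fun_prop

theorem T_pow_mem_Gamma (N : ℕ) : ModularGroup.T ^ N ∈ CongruenceSubgroup.Gamma N := by
  have := ModularGroup.coe_T_zpow N
  rw [zpow_natCast] at this
  rw [CongruenceSubgroup.Gamma_mem, this]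
  simp

theorem conj_T_pow_mem_Gamma (N : ℕ) (g : SL(2, ℤ)) :
    g * ModularGroup.T ^ N * g⁻¹ ∈ CongruenceSubgroup.Gamma N :=
  (CongruenceSubgroup.Gamma_normal N).conj_mem _ (T_pow_mem_Gamma N) g

theorem chart_one_of_pos (x : ℝ) {t : ℝ≥0} (ht : 0 < t) : BorelSerre.chart 1 (x, t) =
    BorelSerre.interior ⟨⟨x, (t : ℝ)⁻¹⟩, by simpa using ht⟩ := by
  rw [BorelSerre.chart, dif_pos ht, one_smul]

theorem coe_ne_map_infty (x : ℝ) :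
    (x : OnePoint ℝ) ≠ (OnePoint.infty : OnePoint ℚ).map (Rat.castHom ℝ) :=
  OnePoint.coe_ne_infty x

theorem chart_one_zero (x : ℝ) : BorelSerre.chart 1 (x, 0) =
    BorelSerre.boundary OnePoint.infty (x : OnePoint ℝ) (coe_ne_map_infty x) := by
  rw [BorelSerre.chart, dif_neg (lt_irrefl _), one_smul]

theorem chart_eq_smul (g : SL(2, ℤ)) (p : ℝ × ℝ≥0) :
    BorelSerre.chart g p = g • BorelSerre.chart 1 p := by
  rw [BorelSerre.smul_chart, mul_one]

theorem T_pow_smul_chart_one (N : ℕ) (x : ℝ) (t : ℝ≥0) :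
    ModularGroup.T ^ N • BorelSerre.chart 1 (x, t) = BorelSerre.chart 1 (x + N, t) := by
  have hT := ModularGroup.coe_T_zpow N
  rw [zpow_natCast] at hT
  generalize ModularGroup.T ^ N = g at *
  rcases eq_or_ne t 0 with rfl | ht
  · rw [chart_one_zero, chart_one_zero, BorelSerre.smul_boundary]
    congr 1
    · rw [OnePoint.smul_infty_eq_self_iff]
      simp [hT]
    · rw [OnePoint.smul_some_eq_ite]
      simp [hT]
  · rw [chart_one_of_pos _ (pos_iff_ne_zero.2 ht), chart_one_of_pos _ (pos_iff_ne_zero.2 ht),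
      BorelSerre.smul_interior]
    congr 1
    ext
    rw [UpperHalfPlane.coe_specialLinearGroup_apply]
    simp [hT]
    apply Complex.ext <;> simp

theorem conj_smul_chart (N : ℕ) (g : SL(2, ℤ)) (x : ℝ) (t : ℝ≥0) :
    (g * ModularGroup.T ^ N * g⁻¹) • BorelSerre.chart g (x, t) =
      BorelSerre.chart g (x + N, t) := by
  rw [chart_eq_smul, chart_eq_smul g, smul_smul, inv_mul_cancel_right, mul_smul,
    T_pow_smul_chart_one]

/-! ### The spectacle cycle and its representative in the upper half plane -/

/-- The cycle of the upper half plane homologous to the spectacle cycle: the caps are pushed to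
height `1`, where the two halves of the imaginary axis meet, so that the axis disappears. -/
def innerCycle (N : ℕ) {k : ℕ} (w w' : Harm k) : Chain 1 ℍ (Harm k) :=
  Finsupp.single (translate ModularGroup.S (ofPath (horocycle N))) w' -
    Finsupp.single (ofPath (horocycle N)) w

theorem S_smul_I : ModularGroup.S • UpperHalfPlane.I = UpperHalfPlane.I := by
  ext
  rw [UpperHalfPlane.modular_S_smul]
  simp

theorem horocycle_zero (N : ℕ) : horocycle N 0 = UpperHalfPlane.I := by
  ext
  apply Complex.ext <;> simp [horocycle]

theorem T_pow_smul (N : ℕ) (z : ℍ) : ((ModularGroup.T ^ N • z : ℍ) : ℂ) = z + N := by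
  have := ModularGroup.coe_T_zpow_smul_eq z (n := N)
  simpa using this

theorem horocycle_one (N : ℕ) : horocycle N 1 = ModularGroup.T ^ N • horocycle N 0 := by
  ext
  rw [T_pow_smul]
  apply Complex.ext <;> simp [horocycle]

/-- The two copies of the point at which the caps of `innerCycle` are based coincide. -/
theorem isCycle_innerCycle {N k : ℕ} {v w w' : Harm k}
    (hw : rho k (ModularGroup.T ^ N)⁻¹ w - w = v)
    (hw' : rho k (ModularGroup.S * ModularGroup.T ^ N * ModularGroup.S⁻¹)⁻¹ w' - w' = v) :
    IsCycle N k (innerCycle N w w') := by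
  have h1 := bdry_ofPath_sub_mem (T_pow_mem_Gamma N) (horocycle N) (horocycle_one N) hw
  have h2 := bdry_ofPath_sub_mem (conj_T_pow_mem_Gamma N ModularGroup.S)
    ((⟨fun z => ModularGroup.S • z, continuous_const_smul _⟩ : C(ℍ, ℍ)).comp (horocycle N))
    (by
      change ModularGroup.S • horocycle N 1 = _ • ModularGroup.S • horocycle N 0
      rw [horocycle_one, smul_smul, smul_smul, inv_mul_cancel_right]) hw'
  have e : ((⟨fun z => ModularGroup.S • z, continuous_const_smul _⟩ : C(ℍ, ℍ)).comp
      (horocycle N)) 0 = horocycle N 0 := by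
    change ModularGroup.S • horocycle N 0 = _
    rw [horocycle_zero, S_smul_I]
  rw [e] at h2
  rw [IsCycle, innerCycle, map_sub]
  convert Submodule.sub_mem _ h2 h1 using 1
  rw [sub_sub_sub_cancel_right]
  rfl

/-- The cap bounds `v` at its base point, up to the relations of the coinvariants. -/
theorem cap_mem {N k : ℕ} (g : SL(2, ℤ)) {v w : Harm k}
    (hw : rho k (g * ModularGroup.T ^ N * g⁻¹)⁻¹ w - w = v) :
    bdry 0 k (cap N g w) -
      Finsupp.single (ContinuousMap.const _ (BorelSerre.chart g (0, 0)) : Simplex 0 BorelSerre) v ∈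
        coinvRel N 0 k := by
  have h := bdry_ofPath_sub_mem (conj_T_pow_mem_Gamma N g)
    (⟨fun t => BorelSerre.chart g ((N : ℝ) * (t : ℝ), 0),
      (BorelSerre.continuous_chart g).comp (by fun_prop)⟩ : C(unitInterval, BorelSerre))
    (by simp [conj_smul_chart]) hw
  rw [cap]
  convert h using 3
  simp

/-- The two halves of the imaginary axis meet at `i`. -/
theorem chart_S_one : BorelSerre.chart ModularGroup.S (0, 1) = BorelSerre.chart 1 (0, 1) := by
  rw [chart_eq_smul, chart_one_of_pos _ one_pos, BorelSerre.smul_interior]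
  congr 1
  have h : (⟨⟨0, ((1 : ℝ≥0) : ℝ)⁻¹⟩, by simp⟩ : ℍ) = UpperHalfPlane.I := by
    ext
    apply Complex.ext <;> simp
  rw [h, S_smul_I]

theorem isCycle_spectacle {N k : ℕ} {v w w' : Harm k}
    (hw : rho k (ModularGroup.T ^ N)⁻¹ w - w = v)
    (hw' : rho k (ModularGroup.S * ModularGroup.T ^ N * ModularGroup.S⁻¹)⁻¹ w' - w' = v) :
    IsCycle N k (spectacle N v w w') := by
  have h1 := cap_mem (N := N) (k := k) 1 (v := v) (w := w) (by simpa using hw)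
  have h2 := cap_mem ModularGroup.S hw'
  rw [IsCycle, spectacle, map_add, map_sub, axis, map_add, bdry_ofPath, bdry_ofPath]
  convert Submodule.sub_mem _ h2 h1 using 1
  simp only [ContinuousMap.coe_mk, unitInterval.symm_zero, unitInterval.symm_one]
  have e0 : unitInterval.toNNReal 0 = 0 := rfl
  have e1 : unitInterval.toNNReal 1 = 1 := rfl
  rw [e0, e1, chart_S_one]
  abel

/-- `push` as a linear map. -/
def pushₗ (k : ℕ) : Chain 1 ℍ (Harm k) →ₗ[ℂ] Chain 1 BorelSerre (Harm k) :=
  Finsupp.lmapDomain (Harm k) ℂ fun s => BorelSerre.incl.comp s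

theorem pushₗ_apply {k : ℕ} (Z : Chain 1 ℍ (Harm k)) : pushₗ k Z = push Z := rfl

theorem push_single {k : ℕ} (s : Simplex 1 ℍ) (v : Harm k) :
    push (Finsupp.single s v) = Finsupp.single (BorelSerre.incl.comp s : Simplex 1 BorelSerre) v :=
  Finsupp.mapDomain_single

/-- The homology consists of the two cylinders swept out by the caps on their way along the
imaginary axis; the variation of the sections makes each cylinder bound one half of the axis. -/
theorem homologous_innerCycle {N k : ℕ} {v w w' : Harm k}
    (hw : rho k (ModularGroup.T ^ N)⁻¹ w - w = v)
    (hw' : rho k (ModularGroup.S * ModularGroup.T ^ N * ModularGroup.S⁻¹)⁻¹ w' - w' = v) :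
    Homologous N k (push (innerCycle N w w')) (spectacle N v w w') := by
  have h1 := cylinder_mem (T_pow_mem_Gamma N)
    (⟨fun p => BorelSerre.chart 1
      ((N : ℝ) * (p.1 : ℝ), unitInterval.toNNReal (unitInterval.symm p.2)),
      (BorelSerre.continuous_chart 1).comp (by fun_prop)⟩ :
      C(unitInterval × unitInterval, BorelSerre))
    (fun t => by simp [T_pow_smul_chart_one]) hw
  have h2 := cylinder_mem (conj_T_pow_mem_Gamma N ModularGroup.S)
    (⟨fun p => BorelSerre.chart ModularGroup.S ((N : ℝ) * (p.1 : ℝ), unitInterval.toNNReal p.2),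
      (BorelSerre.continuous_chart ModularGroup.S).comp (by fun_prop)⟩ :
      C(unitInterval × unitInterval, BorelSerre))
    (fun t => by simp [conj_smul_chart]) hw'
  have h := Submodule.neg_mem _ (Submodule.add_mem _ h1 h2)
  rw [Homologous]
  convert h using 1
  have e0 : unitInterval.toNNReal 0 = 0 := rfl
  have e1 : unitInterval.toNNReal 1 = 1 := rfl
  have f0 : push (innerCycle N w w') =
      Finsupp.single (BorelSerre.incl.comp
        (translate ModularGroup.S (ofPath (horocycle N)))) w' -
      Finsupp.single (BorelSerre.incl.comp (ofPath (horocycle N))) w := by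
    rw [← pushₗ_apply, innerCycle, map_sub, pushₗ_apply, pushₗ_apply, push_single, push_single]
  have g0 (x : ℝ) : BorelSerre.chart 1 (x, 1) = BorelSerre.interior ⟨⟨x, 1⟩, one_pos⟩ := by
    rw [chart_one_of_pos _ one_pos]
    simp
  have f1 : BorelSerre.incl.comp (ofPath (horocycle N)) = ofPath
      ⟨fun t => BorelSerre.chart 1 ((N : ℝ) * (t : ℝ), 1),
        (BorelSerre.continuous_chart 1).comp (by fun_prop)⟩ := by
    ext p
    exact (g0 _).symm
  have f2 : BorelSerre.incl.comp (translate ModularGroup.S (ofPath (horocycle N))) = ofPath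
      ⟨fun t => BorelSerre.chart ModularGroup.S ((N : ℝ) * (t : ℝ), 1),
        (BorelSerre.continuous_chart _).comp (by fun_prop)⟩ := by
    ext p
    change BorelSerre.interior (ModularGroup.S • _) = BorelSerre.chart ModularGroup.S (_, 1)
    rw [chart_eq_smul, g0, BorelSerre.smul_interior]
    rfl
  rw [f0, f1, f2, spectacle, axis, cap, cap]
  simp only [ContinuousMap.comp, Function.comp_def, ContinuousMap.coe_mk, unitInterval.symm_zero,
    unitInterval.symm_one, e0, e1, Set.Icc.coe_zero, mul_zero]
  abel

/-! ### An equivariant retraction of the Borel–Serre enlargement -/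

/-- The point `x + i`. -/
def cuspPoint (x : ℝ) : ℍ := ⟨⟨x, 1⟩, one_pos⟩

theorem exists_boundary_eq_chart (l : OnePoint ℚ) (x : OnePoint ℝ)
    (h : x ≠ l.map (Rat.castHom ℝ)) :
    ∃ (g : SL(2, ℤ)) (y : ℝ), BorelSerre.boundary l x h = BorelSerre.chart g (y, 0) := by
  obtain ⟨g, hg⟩ := l.exists_mem_SL2 ℤ
  have hy : Matrix.SpecialLinearGroup.mapGL ℝ g⁻¹ • x ≠ OnePoint.infty := by
    intro h'
    rw [map_inv, inv_smul_eq_iff] at h'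
    apply h
    rw [h', ← hg, BorelSerre.map_smul_cusp]
    rfl
  obtain ⟨y, hy⟩ := OnePoint.ne_infty_iff_exists.1 hy
  refine ⟨g, y, ?_⟩
  rw [chart_eq_smul, chart_one_zero, BorelSerre.smul_boundary]
  congr 1
  · exact hg.symm
  · rw [hy, map_inv, smul_inv_smul]

/-- The points added at a cusp correspond equivariantly to points of `ℍ`: an element of `SL₂(ℤ)`
fixing `∞` is a translation up to sign. -/
theorem smul_cuspPoint_eq {g : SL(2, ℤ)} {x y : ℝ}
    (h : g • BorelSerre.chart 1 (x, 0) = BorelSerre.chart 1 (y, 0)) :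
    g • cuspPoint x = cuspPoint y := by
  rw [chart_one_zero, chart_one_zero, BorelSerre.smul_boundary] at h
  injection h with h1 h2
  rw [OnePoint.smul_infty_eq_self_iff] at h1
  have hc : g 1 0 = 0 := by simpa using h1
  have hdet : g 0 0 * g 1 1 = 1 := by
    have := g.det_coe
    rw [Matrix.det_fin_two, hc] at this
    simpa using this
  have hd : (g 1 1 : ℝ) ≠ 0 := by
    intro h0
    have : g 1 1 = 0 := by exact_mod_cast h0
    rw [this, mul_zero] at hdet
    exact zero_ne_one hdet
  have had : (g 0 0 : ℝ) = g 1 1 := by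
    rcases Int.mul_eq_one_iff_eq_one_or_neg_one.1 hdet with h | h <;> rw [h.1, h.2]
  rw [OnePoint.smul_some_eq_ite] at h2
  simp only [Matrix.SpecialLinearGroup.mapGL_coe_matrix, Matrix.map_apply, hc,
    algebraMap_int_eq, Int.coe_castRingHom, Int.cast_zero, zero_mul, zero_add, hd, if_false,
    Matrix.SpecialLinearGroup.map_apply_coe, RingHom.mapMatrix_apply] at h2
  have h3 := OnePoint.coe_injective h2
  ext
  rw [UpperHalfPlane.coe_specialLinearGroup_apply]
  have hd' : (g 1 1 : ℂ) ≠ 0 := by exact_mod_cast hd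
  have had' : (g 0 0 : ℂ) = g 1 1 := by exact_mod_cast had
  have h4 : ((g 0 0 : ℂ) * x + g 0 1) / g 1 1 = y := by exact_mod_cast h3
  have e (a : ℤ) : ((algebraMap ℤ ℝ a : ℝ) : ℂ) = a := by simp
  rw [e, e, e, e, hc, Int.cast_zero, zero_mul, zero_add]
  change ((g 0 0 : ℂ) * (⟨x, 1⟩ : ℂ) + g 0 1) / g 1 1 = (⟨y, 1⟩ : ℂ)
  rw [Complex.mk_eq_add_mul_I, Complex.mk_eq_add_mul_I, ← h4, had']
  field_simp
  push_cast
  ring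

/-- A map from the Borel–Serre enlargement onto `ℍ`, which is not continuous: the end of the
geodesic from `x` to `∞` goes to `x + i`, and similarly at the other cusps. -/
def retract : BorelSerre → ℍ
  | .interior z => z
  | .boundary l x h => (exists_boundary_eq_chart l x h).choose •
      cuspPoint (exists_boundary_eq_chart l x h).choose_spec.choose

theorem retract_chart_zero (g : SL(2, ℤ)) (x : ℝ) :
    retract (BorelSerre.chart g (x, 0)) = g • cuspPoint x := by
  obtain ⟨l, y, h, hl⟩ : ∃ l y h, BorelSerre.chart g (x, 0) = BorelSerre.boundary l y h := by
    rw [chart_eq_smul, chart_one_zero, BorelSerre.smul_boundary]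
    exact ⟨_, _, _, rfl⟩
  have h1 := hl.trans (exists_boundary_eq_chart l y h).choose_spec.choose_spec
  rw [hl]
  change _ • cuspPoint _ = _
  generalize (exists_boundary_eq_chart l y h).choose_spec.choose = y' at h1 ⊢
  generalize (exists_boundary_eq_chart l y h).choose = g' at h1 ⊢
  rw [chart_eq_smul, chart_eq_smul g', ← inv_smul_eq_iff, smul_smul] at h1
  have h2 := smul_cuspPoint_eq h1
  rw [mul_smul, inv_smul_eq_iff] at h2
  exact h2.symm

theorem retract_smul (g : SL(2, ℤ)) (p : BorelSerre) : retract (g • p) = g • retract p := by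
  cases p with
  | interior z => rfl
  | boundary l x h =>
    obtain ⟨g', y, hy⟩ := exists_boundary_eq_chart l x h
    rw [hy, BorelSerre.smul_chart, retract_chart_zero, retract_chart_zero, mul_smul]

/-! ### Primitives -/

/-- A holomorphic function on the upper half plane has a primitive. -/
theorem exists_primitive {φ : ℂ → ℂ} (hφ : DifferentiableOn ℂ φ {z | 0 < z.im}) :
    ∃ Φ : ℂ → ℂ, ∀ z : ℂ, 0 < z.im → HasDerivAt Φ (φ z) z := by
  -- transport by the Cayley transform from the unit disc
  have hne {w : ℂ} (hw : w ∈ Metric.ball (0 : ℂ) 1) : 1 - w ≠ 0 := by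
    intro h
    rw [sub_eq_zero] at h
    simp [← h] at hw
  have him {w : ℂ} (hw : w ∈ Metric.ball (0 : ℂ) 1) :
      0 < (Complex.I * (1 + w) / (1 - w)).im := by
    have h1 : 0 < Complex.normSq (1 - w) := Complex.normSq_pos.2 (hne hw)
    have h2 : Complex.normSq w < 1 := by
      rw [mem_ball_zero_iff] at hw
      rw [Complex.normSq_eq_norm_sq]
      nlinarith [norm_nonneg w]
    have h3 : (Complex.I * (1 + w) / (1 - w)).im =
        (1 - Complex.normSq w) / Complex.normSq (1 - w) := by
      rw [Complex.div_im, ← sub_div]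
      simp [Complex.normSq_apply]
      ring
    rw [h3]
    exact div_pos (by linarith) h1
  have hd : DifferentiableOn ℂ (fun w => φ (Complex.I * (1 + w) / (1 - w)) *
      (2 * Complex.I / (1 - w) ^ 2)) (Metric.ball 0 1) := by
    refine DifferentiableOn.mul (hφ.comp ?_ fun w hw => him hw) ?_
    · exact DifferentiableOn.div (by fun_prop) (by fun_prop) fun w hw => hne hw
    · exact DifferentiableOn.div (by fun_prop) (by fun_prop) fun w hw => pow_ne_zero _ (hne hw)
  obtain ⟨Ψ, hΨ⟩ := hd.isExactOn_ball
  refine ⟨fun z => Ψ ((z - Complex.I) / (z + Complex.I)), fun z hz => ?_⟩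
  have hz' : z + Complex.I ≠ 0 := by
    intro h
    have := congrArg Complex.im h
    simp at this
    linarith
  have hmem : (z - Complex.I) / (z + Complex.I) ∈ Metric.ball (0 : ℂ) 1 := by
    rw [mem_ball_zero_iff, norm_div, div_lt_one (norm_pos_iff.2 hz'),
      ← sq_lt_sq₀ (norm_nonneg _) (norm_nonneg _), ← Complex.normSq_eq_norm_sq,
      ← Complex.normSq_eq_norm_sq, Complex.normSq_apply, Complex.normSq_apply]
    simp
    nlinarith
  have h1 : HasDerivAt (fun z => (z - Complex.I) / (z + Complex.I))
      (2 * Complex.I / (z + Complex.I) ^ 2) z := by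
    refine (((hasDerivAt_id z).sub_const Complex.I).div
      ((hasDerivAt_id z).add_const Complex.I) hz').congr_deriv ?_
    change (1 * (z + Complex.I) - (z - Complex.I) * 1) / (z + Complex.I) ^ 2 = _
    ring
  refine ((hΨ _ hmem).comp z h1).congr_deriv ?_
  have e1 : 1 - (z - Complex.I) / (z + Complex.I) = 2 * Complex.I / (z + Complex.I) := by
    field_simp; ring
  have e2 : 1 + (z - Complex.I) / (z + Complex.I) = 2 * z / (z + Complex.I) := by
    field_simp; ring
  have hI := Complex.I_ne_zero
  have e3 : Complex.I * (2 * z / (z + Complex.I)) / (2 * Complex.I / (z + Complex.I)) = z := by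
    field_simp
  beta_reduce
  rw [e1, e2, e3]
  field_simp

/-! ### Potentials -/

open scoped ModularForm

/-- `G` is a primitive of the form `η_f` with values in the dual of `H_k(V_ℂ)`. -/
def IsPotential (k : ℕ) (f : ℍ → ℂ) (G : ℂ → Harm k →ₗ[ℂ] ℂ) : Prop :=
  ∀ (v : Harm k) (z : ℍ), HasDerivAt (fun z => G z v) (f z * (toPoly v).eval (z : ℂ)) z

theorem exists_isPotential (k : ℕ) {f : ℍ → ℂ}
    (hf : DifferentiableOn ℂ (f ∘ UpperHalfPlane.ofComplex) {z | 0 < z.im}) :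
    ∃ G, IsPotential k f G := by
  have h (m : ℕ) := exists_primitive (φ := fun z => (f ∘ UpperHalfPlane.ofComplex) z * z ^ m)
    (hf.mul (by fun_prop))
  choose Φ hΦ using h
  refine ⟨fun z => (Polynomial.lsum fun m => LinearMap.toSpanSingleton ℂ ℂ (Φ m z)) ∘ₗ
    toPoly.toLinearMap ∘ₗ (Harm k).subtype, fun v z => ?_⟩
  simp only [LinearMap.comp_apply, Polynomial.lsum_apply, Polynomial.sum_def,
    LinearMap.toSpanSingleton_apply, Submodule.subtype_apply, AlgHom.toLinearMap_apply]
  rw [Polynomial.eval_eq_sum, Polynomial.sum_def, Finset.mul_sum]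
  refine HasDerivAt.fun_sum fun m _ => ?_
  refine ((hΦ m z z.im_pos).const_smul ((toPoly (v : SymV)).coeff m)).congr_deriv ?_
  rw [Function.comp_apply, UpperHalfPlane.ofComplex_apply, smul_eq_mul]
  ring

/-- The pullback of `η_f` by `g` is `g η_{f | g}`. -/
theorem IsPotential.hasDerivAt_smul {k : ℕ} {f : ℍ → ℂ} {G : ℂ → Harm k →ₗ[ℂ] ℂ}
    (hG : IsPotential k f G) (g : SL(2, ℤ)) (v : Harm k) (z : ℍ) :
    HasDerivAt (fun z : ℂ => G (g • UpperHalfPlane.ofComplex z : ℍ) (rho k g v))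
      ((f ∣[2 * (k : ℤ) + 2] g) z * (toPoly v).eval (z : ℂ)) z := by
  have hdet : ((g : GL (Fin 2) ℝ) : Matrix (Fin 2) (Fin 2) ℝ).det = 1 := by
    rw [← Matrix.GeneralLinearGroup.val_det_apply]
    simp
  have h1 := (UpperHalfPlane.hasStrictDerivAt_smul (hdet ▸ one_pos) z).hasDerivAt
  have h2 := hG (rho k g v) (g • z)
  have e : ((g • z : ℍ) : ℂ) = ((g : GL (Fin 2) ℝ) • UpperHalfPlane.ofComplex (z : ℂ) : ℍ) := by
    rw [UpperHalfPlane.ofComplex_apply]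
    rfl
  rw [e] at h2
  refine (h2.comp (z : ℂ) h1).congr_deriv ?_
  rw [← e]
  have hd : UpperHalfPlane.denom (g : GL (Fin 2) ℝ) z = (g 1 0 : ℂ) * z + g 1 1 := by
    rw [ModularGroup.denom_apply]
  have hd0 : (g 1 0 : ℂ) * z + g 1 1 ≠ 0 := hd ▸ UpperHalfPlane.denom_ne_zero _ z
  have e' : ((g 1 0 : ℂ) * z + g 1 1) * ((g • z : ℍ) : ℂ) = g 0 0 * z + g 0 1 := by
    rw [UpperHalfPlane.coe_specialLinearGroup_apply]
    simp
    field_simp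
  rw [ModularForm.SL_slash_apply, ← toPoly_rho g v _ _ e', hd]
  rw [hdet, Complex.ofReal_one, zpow_neg,
    show (2 * (k : ℤ) + 2) = ((2 * k + 2 : ℕ) : ℤ) by push_cast; rfl,
    zpow_natCast, pow_add]
  field_simp

/-- If `f` is modular, `G` and its transform by `g` have the same derivative. -/
theorem IsPotential.isQuasiInvariant {N k : ℕ} {f : ℍ → ℂ} {G : ℂ → Harm k →ₗ[ℂ] ℂ}
    (hG : IsPotential k f G)
    (hf : ∀ g ∈ CongruenceSubgroup.Gamma N, f ∣[2 * (k : ℤ) + 2] g = f) :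
    IsQuasiInvariant N fun z : ℍ => G z := by
  intro g hg p q v
  have h (z : ℂ) (hz : z ∈ {z : ℂ | 0 < z.im}) : HasDerivAt
      (fun z : ℂ => G (g • UpperHalfPlane.ofComplex z : ℍ) (rho k g v) - G z v) 0 z := by
    have := (hG.hasDerivAt_smul g v ⟨z, hz⟩).sub (hG v ⟨z, hz⟩)
    rwa [hf g hg, sub_self] at this
  have h' := (convex_halfSpace_im_gt 0).is_const_of_fderivWithin_eq_zero (𝕜 := ℂ)
    (fun z hz => (h z hz).differentiableAt.differentiableWithinAt)
    (fun z hz => by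
      have := (h z hz).hasFDerivAt.hasFDerivWithinAt (s := {z : ℂ | 0 < z.im})
      rw [this.fderivWithin ((isOpen_lt continuous_const Complex.continuous_im).uniqueDiffOn z hz)]
      ext
      simp) p.im_pos q.im_pos
  simpa using h'

/-- The retraction onto `ℍ` extends quasi-invariant families to the Borel–Serre enlargement,
although not continuously. -/
theorem IsQuasiInvariant.comp_retract {N k : ℕ} {F : ℍ → Harm k →ₗ[ℂ] ℂ}
    (hF : IsQuasiInvariant N F) : IsQuasiInvariant N fun p => F (retract p) := by
  intro g hg p q v
  simp only [retract_smul]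
  exact hF g hg _ _ v

theorem cochain_comp_retract_push {k : ℕ} (F : ℍ → Harm k →ₗ[ℂ] ℂ) (Z : Chain 1 ℍ (Harm k)) :
    cochain (fun p => F (retract p)) (push Z) = cochain F Z := by
  rw [← pushₗ_apply]
  induction Z using Finsupp.induction_linear with
  | zero => simp
  | add a b ha hb => rw [map_add, map_add, map_add, ha, hb]
  | single s v =>
    rw [pushₗ_apply, push_single, cochain_single, cochain_single]
    rfl

/-! ### The integral of the form over smooth chains -/

theorem curve_zero (s : Simplex 1 ℍ) : curve s 0 = vert s 0 := by
  rw [curve, Set.projIcc_of_le_left _ le_rfl]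
  exact congrArg s (stdSimplexHomeomorphUnitInterval.symm_apply_eq.2 rfl)

theorem curve_one (s : Simplex 1 ℍ) : curve s 1 = vert s 1 := by
  rw [curve, Set.projIcc_of_right_le _ le_rfl]
  exact congrArg s (stdSimplexHomeomorphUnitInterval.symm_apply_eq.2 rfl)

theorem IsPotential.integralSimplex_eq {k : ℕ} {f : ℍ → ℂ} {G : ℂ → Harm k →ₗ[ℂ] ℂ}
    (hG : IsPotential k f G) (hf : Continuous f) {s : Simplex 1 ℍ} (v : Harm k)
    (hs : ContDiffOn ℝ ∞ (fun t => (curve s t : ℂ)) (Set.Icc 0 1)) :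
    integralSimplex k f s v = G (vert s 1 : ℍ) v - G (vert s 0 : ℍ) v := by
  have hc : Continuous (curve s) := s.continuous.comp
    (stdSimplexHomeomorphUnitInterval.symm.continuous.comp continuous_projIcc)
  have hu : UniqueDiffOn ℝ (Set.Icc (0 : ℝ) 1) := uniqueDiffOn_Icc zero_lt_one
  have hd {t : ℝ} (ht : t ∈ Set.Icc (0 : ℝ) 1) : HasDerivWithinAt (fun t => G (curve s t) v)
      (form k (eta k f (curve s t)) v *
        derivWithin (fun t => (curve s t : ℂ)) (Set.Icc 0 1) t) (Set.Icc 0 1) t := by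
    rw [form_eta]
    exact (hG v (curve s t)).comp_hasDerivWithinAt t
      ((hs.differentiableOn (by simp) t ht).hasDerivWithinAt)
  rw [integralSimplex, ← curve_zero, ← curve_one]
  refine intervalIntegral.integral_eq_sub_of_hasDerivAt_of_le zero_le_one
    (fun t ht => (hd ht).continuousWithinAt)
    (fun t ht => (hd (Set.Ioo_subset_Icc_self ht)).hasDerivAt (Icc_mem_nhds ht.1 ht.2)) ?_
  refine ContinuousOn.intervalIntegrable ?_
  rw [Set.uIcc_of_le zero_le_one]
  refine ContinuousOn.mul ?_ (hs.continuousOn_derivWithin hu (by simp))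
  simp only [form_eta]
  have := UpperHalfPlane.continuous_coe.comp hc
  refine Continuous.continuousOn (Continuous.mul (hf.comp hc) ?_)
  exact (toPoly (v : SymV)).continuous.comp this

theorem IsPotential.integralChain_eq {k : ℕ} {f : ℍ → ℂ} {G : ℂ → Harm k →ₗ[ℂ] ℂ}
    (hG : IsPotential k f G) (hf : Continuous f) {Z : Chain 1 ℍ (Harm k)} (hZ : IsSmoothChain Z) :
    integralChain k f Z = cochain (fun z : ℍ => G z) Z := by
  rw [integralChain, cochain, Finsupp.lsum_apply]
  exact Finset.sum_congr rfl fun s hs => hG.integralSimplex_eq hf _ (hZ s hs)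

theorem curve_ofPath (p : C(unitInterval, ℍ)) (t : ℝ) :
    curve (ofPath p) t = p (Set.projIcc 0 1 zero_le_one t) := by
  change p (stdSimplexHomeomorphUnitInterval (stdSimplexHomeomorphUnitInterval.symm _)) = _
  rw [Homeomorph.apply_symm_apply]

theorem contDiffOn_curve_horocycle (N : ℕ) :
    ContDiffOn ℝ ∞ (fun t => (curve (ofPath (horocycle N)) t : ℂ)) (Set.Icc 0 1) := by
  have h : ContDiff ℝ ∞ fun t : ℝ => (N * t + Complex.I : ℂ) :=
    (contDiff_const.mul Complex.ofRealCLM.contDiff).add contDiff_const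
  refine h.contDiffOn.congr fun t ht => ?_
  rw [curve_ofPath, Set.projIcc_of_mem _ ht]
  change (⟨_, _⟩ : ℂ) = _
  apply Complex.ext <;> simp

theorem contDiffOn_curve_translate_horocycle (N : ℕ) :
    ContDiffOn ℝ ∞
      (fun t => (curve (translate ModularGroup.S (ofPath (horocycle N))) t : ℂ)) (Set.Icc 0 1) := by
  have h (t : ℝ) : (curve (translate ModularGroup.S (ofPath (horocycle N))) t : ℂ) =
      -(curve (ofPath (horocycle N)) t : ℂ)⁻¹ := by
    change ((ModularGroup.S • curve (ofPath (horocycle N)) t : ℍ) : ℂ) = _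
    rw [UpperHalfPlane.modular_S_smul, UpperHalfPlane.coe_mk, inv_neg]
  simp only [h]
  exact ((contDiffOn_curve_horocycle N).inv fun t _ => UpperHalfPlane.ne_zero _).neg

theorem isSmoothChain_innerCycle (N : ℕ) {k : ℕ} (w w' : Harm k) :
    IsSmoothChain (innerCycle N w w') := by
  classical
  intro s hs
  rcases Finset.mem_union.1 (Finsupp.support_sub hs) with h | h
  · rw [Finset.mem_singleton.1 (Finsupp.support_single_subset h)]
    exact contDiffOn_curve_translate_horocycle N
  · rw [Finset.mem_singleton.1 (Finsupp.support_single_subset h)]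
    exact contDiffOn_curve_horocycle N

/-- The pairing with the spectacle cycle is a difference of values of a potential. -/
theorem IsPotential.hasPairing {N k : ℕ} {f : ℍ → ℂ} {G : ℂ → Harm k →ₗ[ℂ] ℂ}
    (hG : IsPotential k f G) (hc : Continuous f)
    (hf : ∀ g ∈ CongruenceSubgroup.Gamma N, f ∣[2 * (k : ℤ) + 2] g = f) {v w w' : Harm k}
    (hw : rho k (ModularGroup.T ^ N)⁻¹ w - w = v)
    (hw' : rho k (ModularGroup.S * ModularGroup.T ^ N * ModularGroup.S⁻¹)⁻¹ w' - w' = v) :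
    HasPairing N k f (spectacle N v w w') (cochain (fun z : ℍ => G z) (innerCycle N w w')) := by
  have h := homologous_innerCycle hw hw'
  refine ⟨⟨_, isSmoothChain_innerCycle N w w', isCycle_innerCycle hw hw', h⟩,
    fun Z hZ _ hZS => ?_⟩
  have hF := (hG.isQuasiInvariant hf).comp_retract
  rw [hG.integralChain_eq hc hZ, ← cochain_comp_retract_push, ← cochain_comp_retract_push,
    hF.cochain_eq hZS, hF.cochain_eq h]

/-! ### The integral over a horocycle -/

theorem exists_hasDerivAt_eval (q : Polynomial ℂ) :
    ∃ Q : ℂ → ℂ, ∀ z, HasDerivAt Q (q.eval z) z := by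
  refine ⟨fun z => ∑ n ∈ q.support, q.coeff n * (z ^ (n + 1) / (n + 1)), fun z => ?_⟩
  rw [Polynomial.eval_eq_sum, Polynomial.sum_def]
  refine HasDerivAt.fun_sum fun n _ => ?_
  have hn : (n : ℂ) + 1 ≠ 0 := by exact_mod_cast n.succ_ne_zero
  refine (((hasDerivAt_pow (n + 1) z).div_const ((n : ℂ) + 1)).const_mul (q.coeff n)).congr_deriv ?_
  push_cast
  field_simp

/-- The normalisation of `q` by its mean removes the constant of integration. -/
theorem IsCapPoly.primitive_sub_eq {N m : ℕ} {c : ℂ} {q : Polynomial ℂ}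
    (hq : IsCapPoly N (Polynomial.C c * Polynomial.X ^ m) q) {Q : ℂ → ℂ}
    (hQ : ∀ z, HasDerivAt Q (q.eval z) z) (z : ℂ) :
    Q (z + N) - Q z = c * z ^ (m + 1) / (m + 1) := by
  have hm : (m : ℂ) + 1 ≠ 0 := by exact_mod_cast m.succ_ne_zero
  have h (z : ℂ) : HasDerivAt (fun z => Q (z + N) - Q z - c * z ^ (m + 1) / (m + 1)) 0 z := by
    refine ((((hQ (z + N)).comp_add_const z N).sub (hQ z)).sub
      (((hasDerivAt_pow (m + 1) z).const_mul c).div_const ((m : ℂ) + 1))).congr_deriv ?_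
    rw [hq.sub_eq]
    simp
    field_simp
    simp
  have h0 := is_const_of_deriv_eq_zero (fun z => (h z).differentiableAt) (fun z => (h z).deriv) z 0
  have h1 : ∫ x in (0 : ℝ)..N, q.eval (x : ℂ) = Q (N : ℝ) - Q (0 : ℝ) :=
    intervalIntegral.integral_eq_sub_of_hasDerivAt (f := fun x : ℝ => Q x)
      (fun x _ => (hQ x).comp_ofReal)
      ((by fun_prop : Continuous fun x : ℝ => q.eval (x : ℂ)).intervalIntegrable _ _)
  rw [hq.integral_eq_zero] at h1
  simp at h0 h1
  linear_combination h0 - h1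

theorem exists_norm_eval_le (q : Polynomial ℂ) :
    ∃ (C : ℝ) (d : ℕ), 0 ≤ C ∧ ∀ z : ℂ, ∀ r : ℝ, 1 ≤ r → ‖z‖ ≤ r → ‖q.eval z‖ ≤ C * r ^ d := by
  refine ⟨∑ n ∈ q.support, ‖q.coeff n‖, q.natDegree, by positivity, fun z r hr hz => ?_⟩
  rw [Polynomial.eval_eq_sum, Polynomial.sum_def, Finset.sum_mul]
  refine (norm_sum_le _ _).trans (Finset.sum_le_sum fun n hn => ?_)
  rw [norm_mul, norm_pow]
  gcongr
  exact (pow_le_pow_left₀ (norm_nonneg z) hz n).trans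
    (pow_le_pow_right₀ hr (Polynomial.le_natDegree_of_mem_supp n hn))

section Decay

variable {f : ℍ → ℂ} {a₀ : ℂ} {b : ℝ}

theorem exists_norm_sub_le (hdec : (fun τ => f τ - a₀) =O[UpperHalfPlane.atImInfty]
      fun τ => Real.exp (-b * τ.im)) :
    ∃ C A : ℝ, 0 ≤ C ∧ ∀ τ : ℍ, A ≤ τ.im → ‖f τ - a₀‖ ≤ C * Real.exp (-b * τ.im) := by
  obtain ⟨C, hC, h⟩ := hdec.exists_nonneg
  obtain ⟨A, hA⟩ := (UpperHalfPlane.atImInfty_mem _).1 h.bound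
  refine ⟨C, A, hC, fun τ hτ => ?_⟩
  simpa using hA τ hτ

theorem integrableOn_sub_mul_pow (hb : 0 < b) (hc : Continuous f)
    (hdec : (fun τ => f τ - a₀) =O[UpperHalfPlane.atImInfty] fun τ => Real.exp (-b * τ.im))
    (m : ℕ) :
    MeasureTheory.IntegrableOn
      (fun y : ℝ => (f (UpperHalfPlane.ofComplex (Complex.I * y)) - a₀) * (y : ℂ) ^ m)
      (Set.Ioi 1) := by
  obtain ⟨C, A, hC, h⟩ := exists_norm_sub_le hdec
  refine MeasureTheory.IntegrableOn.mono_set ?_ Set.Ioi_subset_Ici_self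
  refine MeasureTheory.LocallyIntegrableOn.integrableOn_of_isBigO_atTop
    (g := fun y : ℝ => y ^ (-2 : ℝ)) ?_ ?_ ?_
  · refine ContinuousOn.locallyIntegrableOn ?_ measurableSet_Ici
    have : ContinuousOn (fun y : ℝ => UpperHalfPlane.ofComplex (Complex.I * y)) (Set.Ici 1) := by
      intro y (hy : 1 ≤ y)
      have h0 : 0 < (Complex.I * y).im := by simp; linarith
      exact (ContinuousAt.comp (f := fun y : ℝ => Complex.I * (y : ℂ))
        (UpperHalfPlane.contMDiffAt_ofComplex (n := 0) h0).continuousAt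
        (by fun_prop)).continuousWithinAt
    exact ((hc.comp_continuousOn this).sub continuousOn_const).mul (by fun_prop)
  · have h1 : (fun y : ℝ => (f (UpperHalfPlane.ofComplex (Complex.I * y)) - a₀) * (y : ℂ) ^ m)
        =O[Filter.atTop] fun y : ℝ => Real.exp (-b * y) * y ^ m := by
      refine Asymptotics.IsBigO.of_bound C ?_
      filter_upwards [Filter.eventually_ge_atTop A, Filter.eventually_gt_atTop 0] with y hy hy0
      have h0 : 0 < (Complex.I * y).im := by simpa
      have h2 := h (UpperHalfPlane.ofComplex (Complex.I * y))
        (by rw [UpperHalfPlane.ofComplex_apply_of_im_pos h0]; simpa using hy)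
      rw [UpperHalfPlane.ofComplex_apply_of_im_pos h0] at h2 ⊢
      have e : UpperHalfPlane.im ⟨Complex.I * y, h0⟩ = y := by
        change (Complex.I * y).im = y
        simp
      rw [e] at h2
      rw [norm_mul, norm_mul, ← mul_assoc, Real.norm_of_nonneg (Real.exp_pos _).le, norm_pow,
        norm_pow, Complex.norm_real]
      gcongr
    refine h1.trans ?_
    refine ((isLittleO_exp_neg_mul_rpow_atTop hb (-2 - m)).isBigO.mul
      (Asymptotics.isBigO_refl (fun y : ℝ => y ^ m) _)).congr' .rfl ?_
    filter_upwards [Filter.eventually_gt_atTop 0] with y hy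
    rw [← Real.rpow_natCast, ← Real.rpow_add hy]
    ring_nf
  · exact ⟨Set.Ioi 1, Filter.Ioi_mem_atTop 1, integrableOn_Ioi_rpow_of_lt (by norm_num) one_pos⟩

/-- A function on the upper half plane whose derivative is of the form `(f - a₀) q`, with `q`
a polynomial, varies little along a high horocycle. -/
theorem tendsto_sub_of_hasDerivAt (hb : 0 < b)
    (hdec : (fun τ => f τ - a₀) =O[UpperHalfPlane.atImInfty] fun τ => Real.exp (-b * τ.im))
    (N : ℕ) {q : Polynomial ℂ} {R : ℂ → ℂ}
    (hR : ∀ z : ℍ, HasDerivAt R ((f z - a₀) * q.eval (z : ℂ)) z) :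
    Filter.Tendsto (fun y : ℝ => R (Complex.I * y + N) - R (Complex.I * y)) Filter.atTop
      (nhds 0) := by
  obtain ⟨C, A, hC, h⟩ := exists_norm_sub_le hdec
  obtain ⟨K, d, hK, hq⟩ := exists_norm_eval_le q
  have hlim : Filter.Tendsto
      (fun y : ℝ => C * K * (1 + N) ^ d * N * (y ^ (d : ℝ) * Real.exp (-b * y)))
      Filter.atTop (nhds 0) := by
    simpa using (tendsto_rpow_mul_exp_neg_mul_atTop_nhds_zero d b hb).const_mul
      (C * K * (1 + N) ^ d * N)
  refine squeeze_zero_norm' ?_ hlim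
  filter_upwards [Filter.eventually_ge_atTop A, Filter.eventually_ge_atTop 1] with y hy hy1
  have hy0 : 0 < y := by linarith
  have him (x : ℝ) : (Complex.I * y + x).im = y := by simp
  have hbound := Convex.norm_image_sub_le_of_norm_hasDerivWithin_le (𝕜 := ℝ)
    (f := fun x : ℝ => R (Complex.I * y + x)) (s := Set.Icc (0 : ℝ) N) (x := 0) (y := N)
    (f' := fun x => (f ⟨Complex.I * y + x, by rw [him]; exact hy0⟩ - a₀) *
      q.eval (Complex.I * y + x))
    (C := C * Real.exp (-b * y) * (K * ((1 + N) * y) ^ d))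
    (fun x _ => ((hR ⟨Complex.I * y + x, by rw [him]; exact hy0⟩).comp_const_add
      (Complex.I * y) (x : ℂ)).comp_ofReal.hasDerivWithinAt)
    (fun x hx => ?_) (convex_Icc _ _) (by simp) (by simp)
  · refine (by simpa using hbound : _ ≤ _).trans_eq ?_
    rw [Real.rpow_natCast, mul_pow]
    ring_nf
  · have h1 := h ⟨Complex.I * y + x, by rw [him]; exact hy0⟩ (by
      change A ≤ (Complex.I * y + x).im; rwa [him])
    have e : UpperHalfPlane.im ⟨Complex.I * y + x, by rw [him]; exact hy0⟩ = y := him x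
    rw [e] at h1
    rw [norm_mul]
    have hx0 := hx.1
    have hxN := hx.2
    refine mul_le_mul h1 (hq _ _ ?_ ?_) (norm_nonneg _) (by positivity)
    · nlinarith
    · refine (norm_add_le _ _).trans ?_
      rw [norm_mul, Complex.norm_I, Complex.norm_real, Complex.norm_real,
        Real.norm_of_nonneg hy0.le, Real.norm_of_nonneg hx0]
      nlinarith

/-- The variation of a primitive of `f q` along the horocycle from `i` to `i + N`, where
`q (z + N) - q z = c z ^ m`. -/
theorem primitive_sub_eq (hb : 0 < b) (hc : Continuous f)
    (hdec : (fun τ => f τ - a₀) =O[UpperHalfPlane.atImInfty] fun τ => Real.exp (-b * τ.im))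
    {N m : ℕ} (hper : Function.Periodic (f ∘ UpperHalfPlane.ofComplex) (N : ℂ)) {c : ℂ}
    {q : Polynomial ℂ} (hq : IsCapPoly N (Polynomial.C c * Polynomial.X ^ m) q) {P : ℂ → ℂ}
    (hP : ∀ z : ℍ, HasDerivAt P (f z * q.eval (z : ℂ)) z) :
    P (Complex.I + N) - P Complex.I = c * Complex.I ^ (m + 1) * (a₀ / (m + 1) -
      ∫ y in Set.Ioi (1 : ℝ),
        (f (UpperHalfPlane.ofComplex (Complex.I * y)) - a₀) * (y : ℂ) ^ m) := by
  obtain ⟨Q, hQ⟩ := exists_hasDerivAt_eval q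
  let R : ℂ → ℂ := fun z => P z - a₀ * Q z
  have hR (z : ℍ) : HasDerivAt R ((f z - a₀) * q.eval (z : ℂ)) z := by
    refine ((hP z).sub ((hQ z).const_mul a₀)).congr_deriv ?_
    ring
  have hlim := tendsto_sub_of_hasDerivAt hb hdec N hR
  have hd : ∀ y ∈ Set.Ici (1 : ℝ), HasDerivAt
      (fun y : ℝ => R (Complex.I * y + N) - R (Complex.I * y))
      (c * Complex.I ^ (m + 1) *
        ((f (UpperHalfPlane.ofComplex (Complex.I * y)) - a₀) * (y : ℂ) ^ m)) y := by
    intro y (hy : 1 ≤ y)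
    have h1 : 0 < (Complex.I * y).im := by simp; linarith
    have h2 : 0 < (Complex.I * y + N).im := by simp; linarith
    have hl : HasDerivAt (fun z : ℂ => Complex.I * z) Complex.I (y : ℂ) := by
      simpa using (hasDerivAt_id (y : ℂ)).const_mul Complex.I
    have h3 := (hR ⟨_, h2⟩).comp (y : ℂ) (hl.add_const (N : ℂ))
    have h4 := (hR ⟨_, h1⟩).comp (y : ℂ) hl
    refine (h3.sub h4).comp_ofReal.congr_deriv ?_
    have e1 := UpperHalfPlane.ofComplex_apply_of_im_pos h1
    have e2 := UpperHalfPlane.ofComplex_apply_of_im_pos h2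
    have e3 := hper (Complex.I * y)
    rw [Function.comp_apply, Function.comp_apply, e2, e1] at e3
    have e4 := hq.sub_eq (Complex.I * y)
    rw [Polynomial.eval_mul, Polynomial.eval_C, Polynomial.eval_pow, Polynomial.eval_X, mul_pow]
      at e4
    rw [e1, e3]
    linear_combination (f ⟨Complex.I * y, h1⟩ - a₀) * Complex.I * e4
  -- the variation of `R` vanishes at height `∞` and has the derivative `hd`
  have hint := MeasureTheory.integral_Ioi_of_hasDerivAt_of_tendsto' hd
    ((integrableOn_sub_mul_pow hb hc hdec m).const_mul _) hlim
  rw [MeasureTheory.integral_const_mul] at hint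
  have h5 := hq.primitive_sub_eq hQ Complex.I
  simp only [Complex.ofReal_one, mul_one, R] at hint
  linear_combination hint + a₀ * h5

end Decay

/-! ### The completed `L`-function -/

section FEPair

open MeasureTheory Set

/-- The integral over `(0, 1)` in the Mellin transform is turned by the functional equation into
an integral over `(1, ∞)`. -/
theorem Λ₀_eq_add (P : WeakFEPair ℂ) (s : ℂ) :
    P.Λ₀ s = (∫ y in Ioi (1 : ℝ), (P.f y - P.f₀) * (y : ℂ) ^ (s - 1)) +
      P.ε * ∫ y in Ioi (1 : ℝ), (P.g y - P.g₀) * (y : ℂ) ^ (P.k - s - 1) := by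
  have hconv : MellinConvergent P.f_modif s :=
    (P.isStrongFEPair_toStrongFEPair.hasMellin s).1
  have htail (u : ℝ → ℂ) (s : ℂ) : mellin ((Ioi 1).indicator u) s =
      ∫ y in Ioi (1 : ℝ), u y * (y : ℂ) ^ (s - 1) := by
    rw [mellin]
    have h (y : ℝ) : (y : ℂ) ^ (s - 1) • (Ioi (1 : ℝ)).indicator u y =
        (Ioi (1 : ℝ)).indicator (fun y => u y * (y : ℂ) ^ (s - 1)) y := by
      by_cases hy : y ∈ Ioi (1 : ℝ) <;> simp [hy, mul_comm]
    simp only [h]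
    rw [setIntegral_indicator measurableSet_Ioi, Ioi_inter_Ioi, max_eq_right zero_le_one]
  have hA : MellinConvergent ((Ioi 1).indicator P.f_modif) s := by
    refine (hconv.indicator (t := Ioi (1 : ℝ)) measurableSet_Ioi).congr_fun (fun y _ => ?_)
      measurableSet_Ioi
    by_cases hy : y ∈ Ioi (1 : ℝ) <;> simp [hy]
  have hB : MellinConvergent ((Ioo 0 1).indicator P.f_modif) s := by
    refine (hconv.indicator (t := Ioo (0 : ℝ) 1) measurableSet_Ioo).congr_fun (fun y _ => ?_)
      measurableSet_Ioi
    by_cases hy : y ∈ Ioo (0 : ℝ) 1 <;> simp [hy]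
  have hadd : P.f_modif = fun y => (Ioi 1).indicator P.f_modif y +
      (Ioo 0 1).indicator P.f_modif y := by
    ext y
    rcases lt_trichotomy y 1 with h | rfl | h
    · by_cases h0 : 0 < y <;> simp [WeakFEPair.f_modif, h, h0, h.le]
    · simp [WeakFEPair.f_modif]
    · simp [WeakFEPair.f_modif, h, h.le]
  have hA' : (Ioi 1).indicator P.f_modif = (Ioi 1).indicator fun y => P.f y - P.f₀ := by
    ext y
    by_cases hy : 1 < y <;> simp [WeakFEPair.f_modif, hy, not_lt_of_gt]
  have hB' : ∀ y ∈ Ioi (0 : ℝ), (Ioo 0 1).indicator P.f_modif y⁻¹ =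
      P.ε * ((y : ℂ) ^ (P.k : ℂ) • (Ioi 1).indicator (fun y => P.g y - P.g₀) y) := by
    intro y (hy : 0 < y)
    by_cases h1 : y ∈ Ioi (1 : ℝ)
    · have h2 : y⁻¹ ∈ Ioo (0 : ℝ) 1 := ⟨inv_pos.2 hy, inv_lt_one_of_one_lt₀ (mem_Ioi.1 h1)⟩
      have h3 := P.hf_modif_FE y hy
      rw [one_div] at h3
      rw [indicator_of_mem h2, h3, indicator_of_mem h1, WeakFEPair.g_modif, Pi.add_apply,
        indicator_of_mem h1, indicator_of_notMem (fun h => absurd h.2 (mem_Ioi.1 h1).not_gt),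
        add_zero, Complex.ofReal_cpow hy.le, smul_eq_mul, smul_eq_mul, mul_assoc]
    · have h2 : y⁻¹ ∉ Ioo (0 : ℝ) 1 := fun h =>
        h1 ((inv_lt_one₀ hy).1 h.2)
      rw [indicator_of_notMem h2, indicator_of_notMem h1, smul_zero, mul_zero]
  have h1 : P.Λ₀ s = mellin ((Ioi 1).indicator P.f_modif) s +
      mellin ((Ioo 0 1).indicator P.f_modif) s := by
    rw [← (hasMellin_add hA hB).2, ← hadd, WeakFEPair.Λ₀]
  rw [h1, hA', htail]
  congr 1
  have h2 := mellin_comp_inv ((Ioo 0 1).indicator P.f_modif) (-s)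
  rw [neg_neg] at h2
  rw [← h2]
  have h3 : mellin (fun y => (Ioo 0 1).indicator P.f_modif y⁻¹) (-s) =
      mellin (fun y => P.ε • ((y : ℂ) ^ (P.k : ℂ) •
        (Ioi 1).indicator (fun y => P.g y - P.g₀) y)) (-s) :=
    setIntegral_congr_fun measurableSet_Ioi fun y hy => by
      beta_reduce
      rw [hB' y hy, smul_eq_mul P.ε]
  rw [h3, mellin_const_smul, mellin_cpow_smul, htail, smul_eq_mul, neg_add_eq_sub]

end FEPair

open scoped ModularForm

section LFunction

variable {N k : ℕ}
  (f : ModularForm ((CongruenceSubgroup.Gamma N).map (Matrix.SpecialLinearGroup.mapGL ℝ))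
    (2 * (k : ℤ) + 2))

theorem periodic_comp_ofComplex :
    Function.Periodic (f ∘ UpperHalfPlane.ofComplex) ((N : ℝ) : ℂ) :=
  SlashInvariantFormClass.periodic_comp_ofComplex f (by simp)

variable [NeZero N]

theorem coeff_zero_qExpansion :
    (UpperHalfPlane.qExpansion N f).coeff 0 = UpperHalfPlane.valueAtInfty f := by
  have hN : (0 : ℝ) < N := Nat.cast_pos.2 (NeZero.pos N)
  exact UpperHalfPlane.qExpansion_coeff_zero hN
    (UpperHalfPlane.analyticAt_cuspFunction_zero hN (periodic_comp_ofComplex f)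
      (ModularFormClass.holo f) (ModularFormClass.bdd_at_infty f)) (periodic_comp_ofComplex f)

theorem weight_pos (k : ℕ) : 0 < 2 * (k : ℤ) + 2 := by positivity

theorem weakFEPair_k : ((ModularForm.weakFEPair (weight_pos k) f).k : ℂ) = 2 * (k : ℂ) + 2 := by
  simp

theorem hasMellin_Λ {s : ℂ} (hs : 2 * (k : ℝ) + 2 < s.re) :
    HasMellin (fun y : ℝ => f (UpperHalfPlane.ofComplex (Complex.I * y)) -
      (UpperHalfPlane.qExpansion N f).coeff 0) s (ModularForm.Λ (weight_pos k) f s) := by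
  rw [coeff_zero_qExpansion]
  exact (ModularForm.weakFEPair (weight_pos k) f).hasMellin (by simpa using hs)

theorem differentiableOn_Λ :
    DifferentiableOn ℂ (ModularForm.Λ (weight_pos k) f) {0, 2 * (k : ℂ) + 2}ᶜ := by
  intro s hs
  rw [Set.mem_compl_iff, Set.mem_insert_iff, Set.mem_singleton_iff, not_or] at hs
  refine ((ModularForm.weakFEPair (weight_pos k) f).differentiableAt_Λ (Or.inl hs.1)
    (Or.inl ?_)).differentiableWithinAt
  rw [weakFEPair_k]
  exact hs.2

theorem isCompletedL_Λ : IsCompletedL N k f (ModularForm.Λ (weight_pos k) f) :=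
  ⟨differentiableOn_Λ f, fun _ hs => ⟨(hasMellin_Λ f hs).1, (hasMellin_Λ f hs).2.symm⟩⟩

/-- The analytic continuation is unique, as the plane without two points is connected. -/
theorem IsCompletedL.eq_Λ {L : ℂ → ℂ} (hL : IsCompletedL N k f L) {s : ℂ} (h0 : s ≠ 0)
    (h1 : s ≠ 2 * (k : ℂ) + 2) : L s = ModularForm.Λ (weight_pos k) f s := by
  have hfin : ({0, 2 * (k : ℂ) + 2} : Set ℂ).Finite := Set.toFinite _
  have ho : IsOpen ({0, 2 * (k : ℂ) + 2} : Set ℂ)ᶜ := hfin.isClosed.isOpen_compl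
  have hconn : IsPreconnected ({0, 2 * (k : ℂ) + 2} : Set ℂ)ᶜ :=
    (hfin.countable.isConnected_compl_of_one_lt_rank (by simp)).isPreconnected
  have hU : {s : ℂ | 2 * (k : ℝ) + 2 < s.re} ∈ nhds (2 * (k : ℂ) + 3) :=
    (isOpen_lt continuous_const Complex.continuous_re).mem_nhds (by
      change 2 * (k : ℝ) + 2 < (2 * (k : ℂ) + 3).re
      simp
      norm_num)
  have hz : (2 * (k : ℂ) + 3) ∈ ({0, 2 * (k : ℂ) + 2} : Set ℂ)ᶜ := by
    rw [Set.mem_compl_iff, Set.mem_insert_iff, Set.mem_singleton_iff, not_or]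
    constructor
    · exact_mod_cast (2 * k + 2).succ_ne_zero
    · intro h
      have : (3 : ℂ) = 2 := add_left_cancel h
      norm_num at this
  refine (hL.1.analyticOnNhd ho).eqOn_of_preconnected_of_eventuallyEq
    ((differentiableOn_Λ f).analyticOnNhd ho) hconn hz ?_ (by simp [h0, h1])
  filter_upwards [hU] with s hs
  rw [(hL.2 s hs).2, (hasMellin_Λ f hs).2]

/-- The value `Λ(f, m + 1)` in terms of the restrictions of `f` and `f | S` to the half-line from
`i` to `i ∞`. The part with `f` comes from the half `y > 1` of the imaginary axis, and the part with
`f | S` from the half `y < 1`. -/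
theorem Λ_natCast_add_one {m r : ℕ} (hmr : m + r = 2 * k) :
    ModularForm.Λ (weight_pos k) f (m + 1) =
      (∫ y in Set.Ioi (1 : ℝ), (f (UpperHalfPlane.ofComplex (Complex.I * y)) -
          UpperHalfPlane.valueAtInfty f) * (y : ℂ) ^ m) -
        UpperHalfPlane.valueAtInfty f / (m + 1) +
      (-1) ^ (k + 1) * ((∫ y in Set.Ioi (1 : ℝ), ((⇑f ∣[2 * (k : ℤ) + 2] ModularGroup.S)
          (UpperHalfPlane.ofComplex (Complex.I * y)) -
          UpperHalfPlane.valueAtInfty (⇑f ∣[2 * (k : ℤ) + 2] ModularGroup.S)) * (y : ℂ) ^ r) -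
        UpperHalfPlane.valueAtInfty (⇑f ∣[2 * (k : ℤ) + 2] ModularGroup.S) / (r + 1)) := by
  have hk : (m : ℂ) + r = 2 * k := by exact_mod_cast hmr
  have e1 : (m : ℂ) + 1 - 1 = m := by ring
  have e2 : 2 * (k : ℂ) + 2 - (m + 1) - 1 = r := by linear_combination -hk
  have e3 : 2 * (k : ℂ) + 2 - (m + 1) = r + 1 := by linear_combination -hk
  have he : (ModularForm.weakFEPair (weight_pos k) f).ε = (-1) ^ (k + 1) := by
    change Complex.I ^ (2 * (k : ℤ) + 2) = _
    rw [show 2 * (k : ℤ) + 2 = ((2 * (k + 1) : ℕ) : ℤ) by push_cast; ring, zpow_natCast, pow_mul,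
      Complex.I_sq]
  rw [ModularForm.Λ, WeakFEPair.Λ, Λ₀_eq_add, weakFEPair_k, he, e1, e2, e3]
  simp only [Complex.cpow_natCast, smul_eq_mul, ModularForm.weakFEPair_f,
    ModularForm.weakFEPair_g, ModularForm.weakFEPair_f₀, ModularForm.weakFEPair_g₀,
    ModularForm.coe_translate, ModularForm.SL_slash]
  ring

end LFunction

/-! ### The pairing -/

open scoped ModularForm Manifold

theorem isBigO_sub_valueAtInfty {N : ℕ} [NeZero N] {f : ℍ → ℂ}
    (hper : Function.Periodic (f ∘ UpperHalfPlane.ofComplex) ((N : ℝ) : ℂ)) (hf : MDiff f)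
    (hb : UpperHalfPlane.IsBoundedAtImInfty f) :
    (fun τ => f τ - UpperHalfPlane.valueAtInfty f) =O[UpperHalfPlane.atImInfty]
      fun τ => Real.exp (-(2 * Real.pi / N) * τ.im) := by
  have h := UpperHalfPlane.exp_decay_sub_atImInfty (Nat.cast_pos.2 (NeZero.pos N)) hper hf hb
  refine h.congr_right fun τ => ?_
  ring_nf

section ModularForm

variable {N k : ℕ}
  (f : ModularForm ((CongruenceSubgroup.Gamma N).map (Matrix.SpecialLinearGroup.mapGL ℝ))
    (2 * (k : ℤ) + 2))

theorem slash_eq_self {g : SL(2, ℤ)} (hg : g ∈ CongruenceSubgroup.Gamma N) :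
    ⇑f ∣[2 * (k : ℤ) + 2] g = f := by
  rw [ModularForm.SL_slash]
  exact SlashInvariantFormClass.slash_action_eq f _ ⟨g, hg, rfl⟩

/-- As `Γ(N)` is normal, `f | S` is modular for `Γ(N)` as well. -/
theorem slash_S_T_pow_smul (z : ℍ) :
    (⇑f ∣[2 * (k : ℤ) + 2] ModularGroup.S) (ModularGroup.T ^ N • z) =
      (⇑f ∣[2 * (k : ℤ) + 2] ModularGroup.S) z := by
  have h : (⇑f ∣[2 * (k : ℤ) + 2] ModularGroup.S) ∣[2 * (k : ℤ) + 2] (ModularGroup.T ^ N) =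
      ⇑f ∣[2 * (k : ℤ) + 2] ModularGroup.S := by
    have h1 := slash_eq_self f (conj_T_pow_mem_Gamma N ModularGroup.S)
    nth_rw 2 [← h1]
    rw [← SlashAction.slash_mul, ← SlashAction.slash_mul, inv_mul_cancel_right]
  have h2 := congrFun h z
  have hT := ModularGroup.coe_T_zpow N
  rw [zpow_natCast] at hT
  rw [ModularForm.SL_slash_apply, ModularGroup.denom_apply, hT] at h2
  simpa using h2

theorem periodic_slash_S : Function.Periodic
    ((⇑f ∣[2 * (k : ℤ) + 2] ModularGroup.S) ∘ UpperHalfPlane.ofComplex) ((N : ℝ) : ℂ) := by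
  intro z
  have him : (z + ((N : ℝ) : ℂ)).im = z.im := by simp
  rw [Function.comp_apply, Function.comp_apply]
  by_cases hz : 0 < z.im
  · rw [UpperHalfPlane.ofComplex_apply_of_im_pos hz,
      UpperHalfPlane.ofComplex_apply_of_im_pos (him ▸ hz), ← slash_S_T_pow_smul f ⟨z, hz⟩]
    refine congrArg _ (UpperHalfPlane.ext ?_)
    rw [T_pow_smul]
    simp
  · rw [UpperHalfPlane.ofComplex_apply_of_im_nonpos (not_lt.1 hz),
      UpperHalfPlane.ofComplex_apply_of_im_nonpos (him ▸ not_lt.1 hz)]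

variable {f}

/-- The value of a potential on the cycle of two horocycles: the horocycle at `∞` contributes the
part of `Λ(f, m + 1)` from the half `y > 1` of the imaginary axis, and the horocycle at `0` the part
from the half `y < 1`. -/
theorem IsPotential.cochain_innerCycle [NeZero N] {G : ℂ → Harm k →ₗ[ℂ] ℂ} (hG : IsPotential k f G)
    {m r : ℕ} (hmr : m + r = 2 * k) {c : ℂ} {v w w' : Harm k}
    (hv : toPoly v = Polynomial.C c * Polynomial.X ^ m) (hw : IsCapVector N k 1 v w)
    (hw' : IsCapVector N k ModularGroup.S v w') :
    cochain (fun z : ℍ => G z) (innerCycle N w w') =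
      c * Complex.I ^ (m + 1) * ModularForm.Λ (weight_pos k) f (m + 1) := by
  have hf := ModularFormClass.holo f
  have hfS : MDiff (⇑f ∣[2 * (k : ℤ) + 2] ModularGroup.S) := hf.slash _ _
  have hb : 0 < 2 * Real.pi / N :=
    div_pos Real.two_pi_pos (Nat.cast_pos.2 (NeZero.pos N))
  have hper := periodic_comp_ofComplex f
  have hperS := periodic_slash_S f
  rw [isCapVector_iff, inv_one, map_one, Module.End.one_apply, Module.End.one_apply, hv] at hw
  rw [isCapVector_iff, toPoly_rho_S_inv (by omega) c hv, show 2 * k - m = r by omega] at hw'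
  have h1 := primitive_sub_eq hb hf.continuous
    (isBigO_sub_valueAtInfty hper hf (ModularFormClass.bdd_at_infty f))
    (by rwa [← Complex.ofReal_natCast]) hw (hG w)
  have h2 := primitive_sub_eq hb hfS.continuous
    (isBigO_sub_valueAtInfty hperS hfS (ModularFormClass.bdd_at_infty_slash f ModularGroup.S))
    (by rwa [← Complex.ofReal_natCast]) hw'
    (hG.hasDerivAt_smul ModularGroup.S (rho k ModularGroup.S⁻¹ w'))
  have e0 : ((horocycle N 0 : ℍ) : ℂ) = Complex.I := by rw [horocycle_zero]; rfl
  have e1 : ((horocycle N 1 : ℍ) : ℂ) = Complex.I + N := by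
    rw [horocycle_one, T_pow_smul, e0]
  rw [Representation.self_inv_apply, ← e1, ← e0, UpperHalfPlane.ofComplex_apply,
    UpperHalfPlane.ofComplex_apply] at h2
  rw [← e1, ← e0] at h1
  have h3 : cochain (fun z : ℍ => G z) (innerCycle N w w') =
      (G (ModularGroup.S • horocycle N 1 : ℍ) w' - G (ModularGroup.S • horocycle N 0 : ℍ) w') -
        (G (horocycle N 1) w - G (horocycle N 0) w) := by
    rw [innerCycle, map_sub, cochain_single, cochain_single]
    rfl
  have hI : (-1 : ℂ) ^ m * Complex.I ^ (r + 1) = (-1) ^ k * Complex.I ^ (m + 1) := by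
    have h4 : Complex.I ^ m * Complex.I ^ r = (-1) ^ k := by
      rw [← pow_add, hmr, pow_mul, Complex.I_sq]
    have h5 : Complex.I ^ m * Complex.I ^ m = (-1) ^ m := by
      rw [← mul_pow, Complex.I_mul_I]
    rw [← h4, ← h5]
    ring
  rw [h3, h1, h2, e0, Λ_natCast_add_one f hmr]
  linear_combination (c * (UpperHalfPlane.valueAtInfty (⇑f ∣[2 * (k : ℤ) + 2] ModularGroup.S) /
      (r + 1) - ∫ y in Set.Ioi (1 : ℝ), ((⇑f ∣[2 * (k : ℤ) + 2] ModularGroup.S)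
          (UpperHalfPlane.ofComplex (Complex.I * y)) -
          UpperHalfPlane.valueAtInfty (⇑f ∣[2 * (k : ℤ) + 2] ModularGroup.S)) * (y : ℂ) ^ r)) * hI

end ModularForm

theorem cConst_eq {k m r : ℕ} {j : ℤ} (hm : (m : ℤ) = k - j) (hr : (r : ℤ) = k + j) :
    cConst k j = weightCoeff k m * Complex.I ^ (m + 1) := by
  have e : 2 * k - m = r := by omega
  rw [cConst, weightCoeff, ← hm, ← hr, Int.toNat_natCast, Int.toNat_natCast, zpow_natCast, e,
    neg_pow]
  ring

end Spectacle

end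

theorem mainTheorem2 (N k : ℕ) [NeZero N]
    (f : ModularForm ((CongruenceSubgroup.Gamma N).map (Matrix.SpecialLinearGroup.mapGL ℝ))
      (2 * (k : ℤ) + 2)) :
    (∃ v : ℤ → Spectacle.Harm k, Spectacle.IsWeightSystem k v) ∧
    (∃ L : ℂ → ℂ, Spectacle.IsCompletedL N k f L) ∧
    ∀ v : ℤ → Spectacle.Harm k, Spectacle.IsWeightSystem k v →
    ∀ L : ℂ → ℂ, Spectacle.IsCompletedL N k f L →
    ∀ j : ℤ, -(k : ℤ) + 1 ≤ j → j ≤ (k : ℤ) - 1 →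
      (∃ w w' : Spectacle.Harm k, Spectacle.IsCapVector N k 1 (v j) w ∧
        Spectacle.IsCapVector N k ModularGroup.S (v j) w') ∧
      ∀ w w' : Spectacle.Harm k, Spectacle.IsCapVector N k 1 (v j) w →
        Spectacle.IsCapVector N k ModularGroup.S (v j) w' →
        Spectacle.IsCycle N k (Spectacle.spectacle N (v j) w w') ∧
        Spectacle.HasPairing N k f (Spectacle.spectacle N (v j) w w')
          (Spectacle.cConst k j * L (k + 1 - j)) := by
  refine ⟨Spectacle.exists_isWeightSystem k, ⟨_, Spectacle.isCompletedL_Λ f⟩, ?_⟩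
  intro v hv L hL j hj1 hj2
  obtain ⟨m, hm⟩ := Int.eq_ofNat_of_zero_le (show 0 ≤ (k : ℤ) - j by omega)
  obtain ⟨r, hr⟩ := Int.eq_ofNat_of_zero_le (show 0 ≤ (k : ℤ) + j by omega)
  have hmr : m + r = 2 * k := by omega
  have hvj := hv.toPoly_eq (m := m) (by omega)
  rw [show (k : ℤ) - m = j by omega] at hvj
  refine ⟨?_, fun w w' hw hw' => ?_⟩
  · obtain ⟨w, hw⟩ := Spectacle.exists_isCapVector (N := N) (m := m) 1 (v j) (by omega)
      (by simpa using hvj)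
    obtain ⟨w', hw'⟩ := Spectacle.exists_isCapVector (N := N) (m := 2 * k - m) ModularGroup.S (v j)
      (by omega) (Spectacle.toPoly_rho_S_inv (by omega) _ hvj)
    exact ⟨w, w', hw, hw'⟩
  · have h1 := hw.1
    rw [one_mul, inv_one, mul_one] at h1
    refine ⟨Spectacle.isCycle_spectacle h1 hw'.1, ?_⟩
    have hf := ModularFormClass.holo f
    obtain ⟨G, hG⟩ := Spectacle.exists_isPotential k (UpperHalfPlane.mdifferentiable_iff.1 hf)
    have hp := hG.hasPairing hf.continuous (fun g hg => Spectacle.slash_eq_self f hg) h1 hw'.1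
    rw [hG.cochain_innerCycle hmr hvj hw hw'] at hp
    have hs : (k : ℂ) + 1 - j = m + 1 := by
      have : (k : ℂ) - j = m := by exact_mod_cast hm
      linear_combination this
    rw [Spectacle.cConst_eq hm.symm hr.symm, hs, hL.eq_Λ]
    · exact hp
    · exact_mod_cast m.succ_ne_zero
    · have : m + 1 ≠ 2 * k + 2 := by omega
      exact_mod_cast this
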